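/- Let $m,n$ be natural numbers, $\mathcal M=\{1,\dots,m\}$, $A_i\in\mathbb R^{n\times n}$ and $d_i\ge 0$ for $i\in\mathcal M$, and let $\Pi=(\pi_{ij})\in\mathbb R^{m\times m}$ satisfy $\pi_{ij}\ge 0$ for $j\ne i$, $\pi_{ii}=-\sum_{j\ne i}\pi_{ij}$ and $\pi_{ii}\neq 0$ for all $i$ (no absorbing mode). Consider the switched linear system $$\dot x(t)=A_{r(t)}x(t),\qquad x(0)=x_0,\quad r(0)=r_0,$$ where $r(t)\in\mathcal M$ is a random switching signal with switching instants $0=t_0<t_1<t_2<\cdots$, the initial mode $r_0$ being entered at time $t_0=0$, such that, whenever mode $i$ is entered at time $t_k$, the signal stays in $i$ almost surely during the fixed dwell time $[t_k,t_k+d_i)$ and afterwards switches with the Markov transition rates $\pi_{ij}$, $j\neq i$; that is, conditionally on the past up to time $t_k$ with $r(t_k)=i$, the random dwell time $\eta=t_{k+1}-(t_k+d_i)$ and the next mode satisfy $$\Pr\{r(t_{k+1})=j,\ \eta>s\}=\frac{\pi_{ij}}{-\pi_{ii}}\,e^{\pi_{ii}s}\qquad(j\ne i,\ s\ge 0).$$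 The system is called stochastically stable if $\mathbb E\left\{\int_0^\infty\|x(t)\|^2\,dt \mid x_0,r_0\right\}<\infty$ for every initial state $x_0\in\mathbb R^n$, every initial mode $r_0\in\mathcal M$ and every realization of such a switching signal, where $\|\cdot\|$ is the Euclidean norm. Then the system is stochastically stable if and only if there exist real symmetric positive definite matrices $P_i\in\mathbb R^{n\times n}$, $i\in\mathcal M$, such that for all $i\in\mathcal M$ the matrix $$A_i^{T}P_i+P_iA_i+\pi_{ii}P_i+\sum_{j\ne i}\pi_{ij}\,e^{A_j^{T}d_j}P_j\,e^{A_jd_j}$$ is negative definite. -/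

import Mathlib

open MeasureTheory Filter Topology

universe u

noncomputable section

namespace SwitchedSystem

/-- The `σ`-algebra generated by the first `k + 1` switching instants `t 0, …, t k` and by the modes
`r (t 0), …, r (t k)` entered at these instants. -/
abbrev history {Ω : Type u} {m : ℕ} (t : ℕ → Ω → ℝ) (r : ℝ → Ω → Fin m) (k : ℕ) :
    MeasurableSpace Ω :=
  MeasurableSpace.comap
    (fun ω (l : Fin (k + 1)) => ((t l ω, r (t l ω) ω) : ℝ × Fin m)) inferInstance

/-- The probability that a Markov jump process with transition rates `Q` which leaves mode `i`
goes to mode `j` when it does so. -/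
def jumpProb {m : ℕ} (Q : Matrix (Fin m) (Fin m) ℝ) (i j : Fin m) : ℝ :=
  if j = i then 0 else Q i j / (-Q i i)

/-- `r` is, under the probability measure `μ`, a random switching signal with fixed dwell times `d`
and transition rates `Q`, started by entering mode `i₀` at time `0`; its switching instants are
`0 = t 0 < t 1 < t 2 < ⋯`.  When mode `i` is entered at time `t k`, the signal stays in `i` for the
fixed time `d i`, and from then on it switches with the transition rates `Q i j`, `j ≠ i`, of a
Markov jump process: given the past up to `t k`, the random dwell time `t (k + 1) - (t k + d i)` is
exponential with parameter `- Q i i`, and, independently of it, the next mode is `j` with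
probability `Q i j / (- Q i i)`. -/
structure IsSwitchingSignal {Ω : Type u} [MeasurableSpace Ω] (μ : Measure Ω) {m : ℕ}
    (d : Fin m → ℝ) (Q : Matrix (Fin m) (Fin m) ℝ) (i₀ : Fin m)
    (t : ℕ → Ω → ℝ) (r : ℝ → Ω → Fin m) : Prop where
  measurable_time : ∀ k, Measurable (t k)
  measurable_mode : ∀ k, Measurable (fun ω => r (t k ω) ω)
  time_zero : ∀ᵐ ω ∂μ, t 0 ω = 0
  mode_zero : ∀ᵐ ω ∂μ, r 0 ω = i₀
  /-- The signal is constant between consecutive switching instants. -/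
  mode_eq : ∀ᵐ ω ∂μ, ∀ k, ∀ s ∈ Set.Ico (t k ω) (t (k + 1) ω), r s ω = r (t k ω) ω
  /-- The joint conditional law of the next mode and of the random dwell time. -/
  cond_law : ∀ (k : ℕ) (j : Fin m) (s : ℝ), 0 ≤ s →
    μ[Set.indicator
        {ω | r (t (k + 1) ω) ω = j ∧ s < t (k + 1) ω - (t k ω + d (r (t k ω) ω))}
        (fun _ => (1 : ℝ)) | history t r k]
      =ᵐ[μ] fun ω => jumpProb Q (r (t k ω) ω) j *
        Real.exp (Q (r (t k ω) ω) (r (t k ω) ω) * s)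

/-- Almost every path of `x` is a solution on `[0, ∞)` of `ẋ(s) = A_{r(s)} x(s)`, `x(0) = x₀`: it is
continuous and at every `s ≥ 0` it has the right derivative `A_{r(s)} x(s)`.  (At a switching
instant the derivative exists only from the right.) -/
def IsTrajectory {Ω : Type u} [MeasurableSpace Ω] (μ : Measure Ω) {m n : ℕ}
    (A : Fin m → Matrix (Fin n) (Fin n) ℝ) (r : ℝ → Ω → Fin m)
    (x₀ : EuclideanSpace ℝ (Fin n)) (x : ℝ → Ω → EuclideanSpace ℝ (Fin n)) : Prop :=
  ∀ᵐ ω ∂μ, x 0 ω = x₀ ∧ ContinuousOn (fun s => x s ω) (Set.Ici 0) ∧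
    ∀ s, 0 ≤ s → HasDerivWithinAt (fun s' => x s' ω)
      (Matrix.toEuclideanCLM (n := Fin n) (𝕜 := ℝ) (A (r s ω)) (x s ω)) (Set.Ici s) s

/-- The switched system `ẋ(t) = A_{r(t)} x(t)` with fixed dwell times `d` and transition rates `Q`
is stochastically stable: `E ∫₀^∞ ‖x(t)‖² dt < ∞` for every initial state `x₀` and every initial
mode `i₀`, whatever the realization of the switching signal. -/
def StochasticallyStable {m n : ℕ} (A : Fin m → Matrix (Fin n) (Fin n) ℝ) (d : Fin m → ℝ)
    (Q : Matrix (Fin m) (Fin m) ℝ) : Prop :=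
  ∀ (x₀ : EuclideanSpace ℝ (Fin n)) (i₀ : Fin m)
    (Ω : Type u) [MeasurableSpace Ω] (μ : Measure Ω) [IsProbabilityMeasure μ]
    (t : ℕ → Ω → ℝ) (r : ℝ → Ω → Fin m) (x : ℝ → Ω → EuclideanSpace ℝ (Fin n)),
    IsSwitchingSignal μ d Q i₀ t r → IsTrajectory μ A r x₀ x →
      ∫⁻ ω, ∫⁻ s in Set.Ici (0 : ℝ), ‖x s ω‖ₑ ^ 2 ∂volume ∂μ < ⊤

end SwitchedSystem

end

namespace SwitchedSystem

open Set ProbabilityTheory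
open scoped ENNReal

/-! ### Flows of linear systems -/

section LinearSystems

variable {V : Type*} [NormedAddCommGroup V] [NormedSpace ℝ V]

/-! Let W_i(y) ∈ [0,∞] be the expected cost when mode i is entered in state y. The pairs (mode,
state) at the switching instants form a Markov chain, so the expected cost of the k-th stage is the
k-th iterate of `step` on `stageCost`, and W is the sum of these (`totalCost`). By
`IsSwitchingSignal.lintegral_eq_totalCost` every realization has cost W, so stability means W < ∞.
This needs switching instants that do not accumulate, and a realization with a trajectory must exist
(`exists_isSwitchingSignal`, `exists_isPath`), or stability could hold vacuously.

The exponential law turns averages over the random dwell time into D_i f(z) = ∫₀^∞ e^{π_ii s}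
f(e^{A_i s} z) ds (`discounted`). With z = e^{A_i d_i} y, the cost equation W = `stageCost` + `step`
W says that W_i(y) is the cost during the fixed dwell time plus D_i(‖·‖² + ∑_{j≠i} π_ij W_j)(z).

Sufficiency: let N_i be minus the matrix of the inequality and v_i(y) = zᵀP_i z. Integrating along
the flow gives D_i N_i(z) + `step` v ≤ v. The stage cost is at most K D_i N_i(z), so K v is a
supersolution of the cost equation and W ≤ K v (`totalCost_le`).

Necessity: let P_i be the form of U_i = D_i(‖·‖² + ∑_{j≠i} π_ij W_j), the cost counted from the end
of the fixed dwell time. Dropping the fixed part gives U_j(e^{A_j d_j} z) ≤ W_j(z), and the Lyapunov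
equation of U_i (`lyapunov_eq_of_discounted`) makes the matrix at most -I. That W and U are
quadratic forms follows from the closure properties of `IsQuadratic`. -/

/-- Only ‖1‖ ≤ 1 is assumed, because the identity operator of the zero space (n = 0) has norm 0. -/
lemma norm_exp_le_exp_norm {R : Type*} [NormedRing R] [NormedAlgebra ℝ R] [CompleteSpace R]
    (h1 : ‖(1 : R)‖ ≤ 1) (x : R) : ‖NormedSpace.exp x‖ ≤ Real.exp ‖x‖ := by
  have hs := NormedSpace.exp_series_hasSum_exp' (𝕂 := ℝ) x
  have hr := NormedSpace.exp_series_hasSum_exp' (𝕂 := ℝ) ‖x‖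
  rw [← Real.exp_eq_exp_ℝ] at hr
  have hpow : ∀ k : ℕ, ‖x ^ k‖ ≤ ‖x‖ ^ k := by
    intro k
    induction k with
    | zero => simpa using h1
    | succ k ih =>
      rw [pow_succ', pow_succ']
      exact (norm_mul_le _ _).trans (by gcongr)
  rw [← hs.tsum_eq]
  refine tsum_of_norm_bounded hr fun k => ?_
  rw [norm_smul, smul_eq_mul, norm_inv, Real.norm_natCast]
  gcongr
  exact hpow k

/-- The flow of the linear differential equation `ẏ = a y`. -/
noncomputable def flow (a : V →L[ℝ] V) (s : ℝ) : V →L[ℝ] V :=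
  NormedSpace.exp (s • a)

section Flow

variable (a : V →L[ℝ] V)

@[simp]
lemma flow_zero (y : V) : flow a 0 y = y := by
  simp [flow]

variable [CompleteSpace V]

lemma flow_add (s u : ℝ) (y : V) :
    flow a (s + u) y = flow a s (flow a u y) := by
  have h : Commute (s • a) (u • a) := ((Commute.refl a).smul_left s).smul_right u
  simp only [flow]
  let := NormedAlgebra.restrictScalars ℚ ℝ (V →L[ℝ] V)
  rw [add_smul, NormedSpace.exp_add_of_commute h]
  rfl

lemma hasDerivAt_flow (s : ℝ) (y : V) :
    HasDerivAt (fun u => flow a u y) (a (flow a s y)) s := by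
  have h := hasDerivAt_exp_smul_const' (𝕂 := ℝ) a s
  exact h.clm_apply (hasDerivAt_const s y) |>.congr_deriv (by simp [flow])

lemma continuous_flow :
    Continuous (fun p : ℝ × V => flow a p.1 p.2) := by
  have h : Continuous (fun s : ℝ => flow a s) :=
    continuous_iff_continuousAt.2 fun s => (hasDerivAt_exp_smul_const' (𝕂 := ℝ) a s).continuousAt
  exact (h.comp continuous_fst).clm_apply continuous_snd

lemma norm_flow_le (s : ℝ) (y : V) :
    ‖flow a s y‖ ≤ Real.exp (|s| * ‖a‖) * ‖y‖ := by
  refine (ContinuousLinearMap.le_opNorm _ _).trans (mul_le_mul_of_nonneg_right ?_ (norm_nonneg y))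
  refine (norm_exp_le_exp_norm ContinuousLinearMap.norm_id_le _).trans_eq ?_
  rw [norm_smul, Real.norm_eq_abs]

/-- The flow is inverted by running time backwards. -/
lemma norm_le_norm_flow (s : ℝ) (y : V) :
    ‖y‖ ≤ Real.exp (|s| * ‖a‖) * ‖flow a s y‖ := by
  have h := norm_flow_le a (-s) (flow a s y)
  rwa [← flow_add, neg_add_cancel, flow_zero, abs_neg] at h

/-- A continuous curve solving `ẏ = a y` from the right follows the flow. -/
lemma eq_flow_of_hasDerivWithinAt {x : ℝ → V} {s₀ s₁ : ℝ}
    (hc : ContinuousOn x (Icc s₀ s₁))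
    (hx : ∀ s ∈ Ico s₀ s₁, HasDerivWithinAt x (a (x s)) (Ici s) s) :
    ∀ s ∈ Icc s₀ s₁, x s = flow a (s - s₀) (x s₀) := by
  have hd : ∀ s, HasDerivAt (fun s => flow a (s - s₀) (x s₀)) (a (flow a (s - s₀) (x s₀))) s := by
    intro s
    have := (hasDerivAt_flow a (s - s₀) (x s₀)).scomp s ((hasDerivAt_id s).sub_const s₀)
    simpa [Function.comp_def] using this
  refine ODE_solution_unique_of_mem_Icc_right (v := fun _ => a) (s := fun _ => univ)
    (K := ‖a‖₊) (fun _ _ => a.lipschitz.lipschitzOnWith) hc hx (fun _ _ => mem_univ _) ?_ ?_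
    (fun _ _ => mem_univ _) (by simp)
  · exact fun s _ => (hd s).continuousAt.continuousWithinAt
  · exact fun s _ => (hd s).hasDerivWithinAt

end Flow

/-! ### Expected costs as iterates of one operator -/

section Operators

variable {m : ℕ} (a : Fin m → V →L[ℝ] V)
  (d : Fin m → ℝ) (Q : Matrix (Fin m) (Fin m) ℝ)

/-- The expected value of `f`, evaluated at the mode and the state at the next switching instant,
when mode `i` is entered in the state `y`. -/
noncomputable def step (f : Fin m → V → ℝ≥0∞) (i : Fin m) (y : V) : ℝ≥0∞ :=
  ∑ j, ENNReal.ofReal (jumpProb Q i j) *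
    ∫⁻ s, f j (flow (a i) (d i + s) y) ∂expMeasure (-Q i i)

/-- The expected cost until the next switching instant when mode `i` is entered in the state `y`. -/
noncomputable def stageCost (i : Fin m) (y : V) : ℝ≥0∞ :=
  ∫⁻ s, (∫⁻ u in Ioc 0 (d i + s), ‖flow (a i) u y‖ₑ ^ 2) ∂expMeasure (-Q i i)

/-- The expected cost over all times when mode `i` is entered in the state `y`. -/
noncomputable def totalCost (i : Fin m) (y : V) : ℝ≥0∞ :=
  ∑' k, ((step a d Q)^[k] (stageCost a d Q)) i y

variable [FiniteDimensional ℝ V] [CompleteSpace V] [MeasurableSpace V] [BorelSpace V]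

lemma measurable_dwellCost (i : Fin m) :
    Measurable fun p : V × ℝ =>
      ∫⁻ u in Ioc 0 p.2, ‖flow (a i) u p.1‖ₑ ^ 2 := by
  have hset : MeasurableSet {q : (V × ℝ) × ℝ | q.2 ∈ Ioc 0 q.1.2} :=
    (measurableSet_lt measurable_const measurable_snd).inter
      (measurableSet_le measurable_snd (measurable_snd.comp measurable_fst))
  have hf : Measurable fun q : (V × ℝ) × ℝ => ‖flow (a i) q.2 q.1.1‖ₑ ^ 2 :=
    (((continuous_flow (a i)).measurable.comp
      (measurable_snd.prodMk (measurable_fst.comp measurable_fst))).enorm).pow_const 2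
  have := (hf.indicator hset).lintegral_prod_right' (ν := (volume : Measure ℝ))
  convert this using 2 with p
  rw [← lintegral_indicator measurableSet_Ioc]
  rfl

variable [hQ : ∀ i, SFinite (expMeasure (-Q i i))]

lemma measurable_stageCost (i : Fin m) : Measurable (stageCost a d Q i) := by
  have h : Measurable fun p : V × ℝ =>
      ∫⁻ u in Ioc 0 (d i + p.2), ‖flow (a i) u p.1‖ₑ ^ 2 :=
    (measurable_dwellCost a i).comp (measurable_fst.prodMk (measurable_snd.const_add (d i)))
  exact h.lintegral_prod_right'

lemma measurable_step {f : Fin m → V → ℝ≥0∞} (hf : ∀ j, Measurable (f j))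
    (i : Fin m) : Measurable (step a d Q f i) := by
  refine Finset.measurable_fun_sum _ fun j _ => Measurable.const_mul ?_ _
  have h : Measurable fun p : V × ℝ => f j (flow (a i) (d i + p.2) p.1) :=
    (hf j).comp ((continuous_flow (a i)).measurable.comp
      ((measurable_snd.const_add (d i)).prodMk measurable_fst))
  exact h.lintegral_prod_right'

lemma measurable_iterate_step (k : ℕ) (i : Fin m) :
    Measurable ((step a d Q)^[k] (stageCost a d Q) i) := by
  induction k generalizing i with
  | zero => exact measurable_stageCost a d Q i
  | succ k ih =>
    rw [Function.iterate_succ_apply']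
    exact measurable_step a d Q ih i

lemma measurable_totalCost (i : Fin m) : Measurable (totalCost a d Q i) :=
  Measurable.tsum fun k => measurable_iterate_step a d Q k i

end Operators

end LinearSystems

/-! ### Rate matrices and the exponential law -/

/-- `Q` is the matrix of transition rates of a Markov jump process without absorbing modes. -/
structure IsRateMatrix {m : ℕ} (Q : Matrix (Fin m) (Fin m) ℝ) : Prop where
  nonneg : ∀ i j, j ≠ i → 0 ≤ Q i j
  diag : ∀ i, Q i i = -∑ j ∈ Finset.univ.erase i, Q i j
  ne_zero : ∀ i, Q i i ≠ 0

namespace IsRateMatrix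

variable {m : ℕ} {Q : Matrix (Fin m) (Fin m) ℝ} (hQ : IsRateMatrix Q)

include hQ

lemma rate_pos (i : Fin m) : 0 < -Q i i := by
  refine lt_of_le_of_ne ?_ (neg_ne_zero.2 (hQ.ne_zero i)).symm
  rw [hQ.diag i, neg_neg]
  exact Finset.sum_nonneg fun j hj => hQ.nonneg i j (Finset.ne_of_mem_erase hj)

lemma jumpProb_nonneg (i j : Fin m) : 0 ≤ jumpProb Q i j := by
  unfold jumpProb
  split_ifs with h
  · exact le_rfl
  · exact div_nonneg (hQ.nonneg i j h) (hQ.rate_pos i).le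

lemma sum_jumpProb (i : Fin m) : ∑ j, jumpProb Q i j = 1 := by
  rw [← Finset.add_sum_erase _ _ (Finset.mem_univ i)]
  have h : ∀ j ∈ Finset.univ.erase i, jumpProb Q i j = Q i j / (-Q i i) := fun j hj =>
    if_neg (Finset.ne_of_mem_erase hj)
  rw [Finset.sum_congr rfl h, ← Finset.sum_div, jumpProb, if_pos rfl, zero_add,
    div_eq_one_iff_eq (hQ.rate_pos i).ne', hQ.diag i, neg_neg]

lemma sum_ofReal_jumpProb (i : Fin m) : ∑ j, ENNReal.ofReal (jumpProb Q i j) = 1 := by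
  rw [← ENNReal.ofReal_sum_of_nonneg fun j _ => hQ.jumpProb_nonneg i j, hQ.sum_jumpProb,
    ENNReal.ofReal_one]

lemma isProbabilityMeasure_expMeasure (i : Fin m) :
    IsProbabilityMeasure (expMeasure (-Q i i)) :=
  ProbabilityTheory.isProbabilityMeasure_expMeasure (hQ.rate_pos i)

end IsRateMatrix

lemma expMeasure_Iic_of_nonneg {c : ℝ} (hc : 0 < c) {s : ℝ} (hs : 0 ≤ s) :
    expMeasure c (Iic s) = 1 - ENNReal.ofReal (Real.exp (-c * s)) := by
  have := isProbabilityMeasure_expMeasure hc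
  rw [← ofReal_cdf, cdf_expMeasure_eq hc, if_pos hs, ENNReal.ofReal_sub _ (Real.exp_pos _).le,
    ENNReal.ofReal_one, neg_mul]

lemma expMeasure_Iic_of_nonpos {c : ℝ} (hc : 0 < c) {s : ℝ} (hs : s ≤ 0) :
    expMeasure c (Iic s) = 0 := by
  have := isProbabilityMeasure_expMeasure hc
  refine measure_mono_null (Iic_subset_Iic.2 hs) ?_
  rw [expMeasure_Iic_of_nonneg hc le_rfl]
  simp

lemma ae_pos_expMeasure {c : ℝ} (hc : 0 < c) : ∀ᵐ s ∂expMeasure c, 0 < s := by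
  rw [ae_iff]
  simp only [not_lt]
  exact expMeasure_Iic_of_nonpos hc le_rfl

lemma lintegral_eq_sum_fibers {Ω ι : Type*} [MeasurableSpace Ω] [Fintype ι] [MeasurableSpace ι]
    [MeasurableSingletonClass ι] (μ : Measure Ω) {g : Ω → ι} (hg : Measurable g) (f : Ω → ℝ≥0∞) :
    ∫⁻ ω, f ω ∂μ = ∑ i, ∫⁻ ω in {ω | g ω = i}, f ω ∂μ := by
  rw [← tsum_fintype (L := .unconditional _), ← lintegral_iUnion]
  · rw [iUnion_eq_univ_iff.2 fun ω => ⟨g ω, rfl⟩, setLIntegral_univ]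
  · exact fun i => hg (measurableSet_singleton i)
  · exact fun i j hij => Set.disjoint_left.2 fun ω hi hj => hij (hi.symm.trans hj)

/-! ### The law of a switching signal -/

lemma measurable_history_pair {Ω : Type u} {m : ℕ} (t : ℕ → Ω → ℝ) (r : ℝ → Ω → Fin m)
    {l k : ℕ} (hl : l ≤ k) : Measurable[history t r k] fun ω => (t l ω, r (t l ω) ω) :=
  (measurable_pi_apply (⟨l, Nat.lt_succ_of_le hl⟩ : Fin (k + 1))).comp
    (comap_measurable (fun ω (l : Fin (k + 1)) => ((t l ω, r (t l ω) ω) : ℝ × Fin m)))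

lemma measurable_history_time {Ω : Type u} {m : ℕ} (t : ℕ → Ω → ℝ) (r : ℝ → Ω → Fin m)
    {l k : ℕ} (hl : l ≤ k) : Measurable[history t r k] (t l) :=
  measurable_fst.comp (measurable_history_pair t r hl)

lemma measurable_history_mode {Ω : Type u} {m : ℕ} (t : ℕ → Ω → ℝ) (r : ℝ → Ω → Fin m)
    {l k : ℕ} (hl : l ≤ k) : Measurable[history t r k] fun ω => r (t l ω) ω :=
  measurable_snd.comp (measurable_history_pair t r hl)

namespace IsSwitchingSignal

variable {Ω : Type u} [MeasurableSpace Ω] {μ : Measure Ω} {m : ℕ} {d : Fin m → ℝ}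
  {Q : Matrix (Fin m) (Fin m) ℝ} {i₀ : Fin m} {t : ℕ → Ω → ℝ} {r : ℝ → Ω → Fin m}

lemma history_le (h : IsSwitchingSignal μ d Q i₀ t r) (k : ℕ) :
    history t r k ≤ ‹MeasurableSpace Ω› :=
  (measurable_pi_lambda _ fun l : Fin (k + 1) =>
    (h.measurable_time l).prodMk (h.measurable_mode l)).comap_le

lemma measurableSet_mode (h : IsSwitchingSignal μ d Q i₀ t r) (k : ℕ) (i : Fin m) :
    MeasurableSet {ω | r (t k ω) ω = i} :=
  h.measurable_mode k (measurableSet_singleton i)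

lemma measurable_remaining (h : IsSwitchingSignal μ d Q i₀ t r) (k : ℕ) (c : ℝ) :
    Measurable fun ω => t (k + 1) ω - (t k ω + c) :=
  (h.measurable_time (k + 1)).sub ((h.measurable_time k).add_const _)

variable [IsProbabilityMeasure μ]

/-- The conditional law integrated over an event of the past. Restricting to a fixed current mode i
makes its right-hand side constant. -/
lemma measure_next (h : IsSwitchingSignal μ d Q i₀ t r) (hQ : IsRateMatrix Q) {k : ℕ}
    {B : Set Ω} (hB : MeasurableSet[history t r k] B) (i j : Fin m) {s : ℝ} (hs : 0 ≤ s) :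
    μ ({ω | r (t (k + 1) ω) ω = j ∧ s < t (k + 1) ω - (t k ω + d i)} ∩
        (B ∩ {ω | r (t k ω) ω = i})) =
      ENNReal.ofReal (jumpProb Q i j) * ENNReal.ofReal (Real.exp (Q i i * s)) *
        μ (B ∩ {ω | r (t k ω) ω = i}) := by
  set B' := B ∩ {ω | r (t k ω) ω = i} with hB'
  have hB'm : MeasurableSet[history t r k] B' :=
    hB.inter (measurable_history_mode t r le_rfl (measurableSet_singleton i))
  have hB'm₀ : MeasurableSet B' := h.history_le k _ hB'm
  set S := {ω | r (t (k + 1) ω) ω = j ∧ s < t (k + 1) ω - (t k ω + d (r (t k ω) ω))} with hS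
  have hdm : Measurable fun ω => d (r (t k ω) ω) := (measurable_of_finite d).comp (h.measurable_mode k)
  have hSm : MeasurableSet S :=
    (h.measurableSet_mode (k + 1) j).inter
      (measurableSet_lt measurable_const
        ((h.measurable_time (k + 1)).sub ((h.measurable_time k).add hdm)))
  have hSB : {ω | r (t (k + 1) ω) ω = j ∧ s < t (k + 1) ω - (t k ω + d i)} ∩ B' = S ∩ B' := by
    ext ω
    simp only [hS, hB', mem_inter_iff, mem_ofPred_eq]
    constructor
    · rintro ⟨h1, h2, rfl⟩
      exact ⟨h1, h2, rfl⟩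
    · rintro ⟨h1, h2, rfl⟩
      exact ⟨h1, h2, rfl⟩
  rw [hSB]
  have hint : Integrable (S.indicator fun _ => (1 : ℝ)) μ :=
    (integrable_const (1 : ℝ)).indicator hSm
  have key := setIntegral_condExp (h.history_le k) hint hB'm
  have hleft : ∫ ω in B', (μ[S.indicator fun _ => (1 : ℝ) | history t r k]) ω ∂μ =
      ∫ ω in B', jumpProb Q i j * Real.exp (Q i i * s) ∂μ := by
    refine setIntegral_congr_ae hB'm₀ ?_
    filter_upwards [h.cond_law k j s hs] with ω hω hωB
    have hi : r (t k ω) ω = i := hωB.2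
    rw [hω, hi]
  rw [hleft, setIntegral_const, setIntegral_indicator hSm, setIntegral_const, smul_eq_mul,
    smul_eq_mul, mul_one, inter_comm] at key
  rw [← ofReal_measureReal (measure_ne_top μ _), ← ofReal_measureReal (measure_ne_top μ B'), ← key,
    ← ENNReal.ofReal_mul (hQ.jumpProb_nonneg i j),
    ← ENNReal.ofReal_mul (mul_nonneg (hQ.jumpProb_nonneg i j) (Real.exp_pos _).le), mul_comm]

/-- At s = 0 the probabilities in the conditional law sum to 1 over the next mode, which leaves no
mass for a dwell time ≤ 0. -/
lemma ae_lt_next (h : IsSwitchingSignal μ d Q i₀ t r) (hQ : IsRateMatrix Q) (k : ℕ) :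
    ∀ᵐ ω ∂μ, 0 < t (k + 1) ω - (t k ω + d (r (t k ω) ω)) := by
  have hi : ∀ i, ∀ᵐ ω ∂μ, r (t k ω) ω = i → 0 < t (k + 1) ω - (t k ω + d i) := by
    intro i
    set B := {ω | r (t k ω) ω = i} with hB
    set S := {ω | 0 < t (k + 1) ω - (t k ω + d i)} with hS
    have hSm : MeasurableSet S := measurableSet_lt measurable_const
        ((h.measurable_time (k + 1)).sub ((h.measurable_time k).add_const _))
    have hBm : MeasurableSet B := h.measurableSet_mode k i
    have hsum : μ (B ∩ S) = μ B := by
      have h1 := lintegral_eq_sum_fibers (μ.restrict (B ∩ S)) (h.measurable_mode (k + 1)) (fun _ => 1)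
      simp only [lintegral_one, Measure.restrict_apply_univ] at h1
      rw [h1]
      have h2 : ∀ j, ((μ.restrict (B ∩ S)).restrict {ω | r (t (k + 1) ω) ω = j}) univ =
          ENNReal.ofReal (jumpProb Q i j) * μ B := by
        intro j
        rw [Measure.restrict_apply_univ, Measure.restrict_apply
          (h.measurableSet_mode (k + 1) j)]
        have h3 := h.measure_next hQ (k := k) (B := univ) MeasurableSet.univ i j le_rfl
        rw [univ_inter, mul_zero, Real.exp_zero, ENNReal.ofReal_one, mul_one] at h3
        rw [← h3]
        congr 1
        ext ω
        simp only [hB, hS, mem_inter_iff, mem_ofPred_eq]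
        tauto
      simp only [Measure.restrict_apply_univ] at h2
      rw [Finset.sum_congr rfl fun j _ => h2 j, ← Finset.sum_mul, hQ.sum_ofReal_jumpProb, one_mul]
    have hdiff : μ (B \ S) = 0 := by
      rw [← sdiff_inter_self_eq_sdiff, inter_comm, measure_sdiff inter_subset_left
        (hBm.inter hSm).nullMeasurableSet (measure_ne_top _ _), hsum, tsub_self]
    rw [ae_iff]
    refine measure_mono_null (fun ω hω => ?_) hdiff
    simpa [hB, hS] using hω
  filter_upwards [ae_all_iff.2 hi] with ω hω using hω _ rfl

/-- Rectangles determine the joint measure. For a fixed event of the past, the remaining dwell time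
has exponential tails on s ≥ 0 and no mass on s ≤ 0, so its law is a multiple of the exponential
law. -/
lemma map_next (h : IsSwitchingSignal μ d Q i₀ t r) (hQ : IsRateMatrix Q) {k : ℕ}
    {β : Type*} [MeasurableSpace β] {X : Ω → β} (hX : Measurable[history t r k] X) (i j : Fin m) :
    (μ.restrict {ω | r (t k ω) ω = i ∧ r (t (k + 1) ω) ω = j}).map
        (fun ω => (X ω, t (k + 1) ω - (t k ω + d i))) =
      ENNReal.ofReal (jumpProb Q i j) •
        ((μ.restrict {ω | r (t k ω) ω = i}).map X).prod (expMeasure (-Q i i)) := by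
  have hexp := hQ.isProbabilityMeasure_expMeasure i
  have hX₀ : Measurable X := hX.mono (h.history_le k) le_rfl
  have hη : Measurable fun ω => t (k + 1) ω - (t k ω + d i) :=
    (h.measurable_time (k + 1)).sub ((h.measurable_time k).add_const _)
  set S := {ω | r (t k ω) ω = i ∧ r (t (k + 1) ω) ω = j} with hS
  have hSm : MeasurableSet S := (h.measurableSet_mode k i).inter
    (h.measurableSet_mode (k + 1) j)
  have hIm : MeasurableSet {ω | r (t k ω) ω = i} := h.measurableSet_mode k i
  have : IsFiniteMeasure ((μ.restrict {ω | r (t k ω) ω = i}).map X) := inferInstance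
  refine (Measure.ext_prod fun {B} {C} hB hC => ?_)
  rw [Measure.map_apply (hX₀.prodMk hη) (hB.prod hC), Measure.smul_apply, Measure.prod_prod,
    Measure.map_apply hX₀ hB, Measure.restrict_apply (hX₀ hB)]
  have hpre : (fun ω => (X ω, t (k + 1) ω - (t k ω + d i))) ⁻¹' (B ×ˢ C) =
      (fun ω => t (k + 1) ω - (t k ω + d i)) ⁻¹' C ∩ X ⁻¹' B := by
    ext ω
    simp [and_comm]
  set B' := X ⁻¹' B ∩ {ω | r (t k ω) ω = i} with hB'
  set B'' := B' ∩ {ω | r (t (k + 1) ω) ω = j} with hB''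
  have hB'm : MeasurableSet B' := (hX₀ hB).inter hIm
  have hB''m : MeasurableSet B'' := hB'm.inter (h.measurableSet_mode (k + 1) j)
  set c := ENNReal.ofReal (jumpProb Q i j) * μ B' with hc
  have hpos : ∀ a ≤ 0, ((μ.restrict B'').map fun ω => t (k + 1) ω - (t k ω + d i)) (Iic a) = 0 := by
    intro a ha
    rw [Measure.map_apply hη measurableSet_Iic, Measure.restrict_apply (hη measurableSet_Iic)]
    refine measure_mono_null ?_ (ae_iff.1 (h.ae_lt_next hQ k))
    rintro ω ⟨h1, ⟨-, h2⟩, -⟩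
    have h1' : t (k + 1) ω - (t k ω + d i) ≤ a := h1
    have h2' : r (t k ω) ω = i := h2
    simp only [mem_ofPred_eq, h2', not_lt]
    linarith
  have hIoi : ∀ a, 0 ≤ a →
      ((μ.restrict B'').map fun ω => t (k + 1) ω - (t k ω + d i)) (Ioi a) =
        c * ENNReal.ofReal (Real.exp (Q i i * a)) := by
    intro a ha
    rw [Measure.map_apply hη measurableSet_Ioi, Measure.restrict_apply (hη measurableSet_Ioi), hc,
      mul_right_comm, ← h.measure_next hQ (hX hB) i j ha]
    congr 1
    ext ω
    simp only [hB'', hB', mem_inter_iff, mem_ofPred_eq, mem_preimage, mem_Ioi]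
    tauto
  have huniv : ((μ.restrict B'').map fun ω => t (k + 1) ω - (t k ω + d i)) univ = c := by
    rw [← compl_union_self (Iic (0 : ℝ)), compl_Iic,
      measure_union (Ioi_disjoint_Iic le_rfl) measurableSet_Iic, hpos 0 le_rfl, hIoi 0 le_rfl]
    simp
  have hmeas : ((μ.restrict B'').map fun ω => t (k + 1) ω - (t k ω + d i)) =
      c • expMeasure (-Q i i) := by
    refine Measure.ext_of_Iic _ _ fun a => ?_
    rw [Measure.smul_apply, smul_eq_mul]
    rcases le_total a 0 with ha | ha
    · rw [hpos a ha, expMeasure_Iic_of_nonpos (hQ.rate_pos i) ha, mul_zero]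
    · rw [← compl_Ioi, measure_compl measurableSet_Ioi (measure_ne_top _ _), huniv, hIoi a ha,
        compl_Ioi, expMeasure_Iic_of_nonneg (hQ.rate_pos i) ha, neg_neg, ENNReal.mul_sub, mul_one]
      exact fun _ _ => by finiteness
  have hev := congrArg (fun ν => ν C) hmeas
  simp only [Measure.smul_apply, smul_eq_mul] at hev
  rw [Measure.map_apply hη hC, Measure.restrict_apply (hη hC), hc] at hev
  rw [smul_eq_mul, ← mul_assoc, ← hev, hpre, Measure.restrict_apply ((hη hC).inter (hX₀ hB))]
  congr 1
  ext ω
  simp only [hS, hB'', hB', mem_inter_iff, mem_ofPred_eq, mem_preimage]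
  tauto

/-- The joint conditional law of the next mode and of the random dwell time, given the past. -/
lemma lintegral_next (h : IsSwitchingSignal μ d Q i₀ t r) (hQ : IsRateMatrix Q) {k : ℕ}
    {β : Type*} [MeasurableSpace β] {X : Ω → β} (hX : Measurable[history t r k] X)
    {F : Fin m → Fin m → β × ℝ → ℝ≥0∞} (hF : ∀ i j, Measurable (F i j)) :
    ∫⁻ ω, F (r (t k ω) ω) (r (t (k + 1) ω) ω)
        (X ω, t (k + 1) ω - (t k ω + d (r (t k ω) ω))) ∂μ =
      ∫⁻ ω, ∑ j, ENNReal.ofReal (jumpProb Q (r (t k ω) ω) j) *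
        ∫⁻ s, F (r (t k ω) ω) j (X ω, s) ∂expMeasure (-Q (r (t k ω) ω) (r (t k ω) ω)) ∂μ := by
  have hX₀ : Measurable X := hX.mono (h.history_le k) le_rfl
  rw [lintegral_eq_sum_fibers μ (h.measurable_mode k),
    lintegral_eq_sum_fibers μ (h.measurable_mode k)]
  refine Finset.sum_congr rfl fun i _ => ?_
  have hexp := hQ.isProbabilityMeasure_expMeasure i
  have hmeas : ∀ j, Measurable fun x => ∫⁻ s, F i j (x, s) ∂expMeasure (-Q i i) := fun j =>
    (hF i j).lintegral_prod_right'
  have hright : ∫⁻ ω in {ω | r (t k ω) ω = i}, (∑ j, ENNReal.ofReal (jumpProb Q (r (t k ω) ω) j) *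
        ∫⁻ s, F (r (t k ω) ω) j (X ω, s) ∂expMeasure (-Q (r (t k ω) ω) (r (t k ω) ω))) ∂μ =
      ∫⁻ ω in {ω | r (t k ω) ω = i}, (∑ j, ENNReal.ofReal (jumpProb Q i j) *
        ∫⁻ s, F i j (X ω, s) ∂expMeasure (-Q i i)) ∂μ :=
    setLIntegral_congr_fun (h.measurableSet_mode k i) fun ω (hω : r (t k ω) ω = i) => by
      simp only [hω]
  have hmeas' : ∀ j, Measurable fun ω => ∫⁻ s, F i j (X ω, s) ∂expMeasure (-Q i i) := fun j =>
    (hmeas j).comp hX₀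
  rw [hright, lintegral_finsetSum _ fun j _ => (hmeas' j).const_mul _,
    lintegral_eq_sum_fibers _ (h.measurable_mode (k + 1))]
  refine Finset.sum_congr rfl fun j _ => ?_
  rw [lintegral_const_mul _ (hmeas' j), Measure.restrict_restrict
    (h.measurableSet_mode (k + 1) j)]
  have hset : {ω | r (t (k + 1) ω) ω = j} ∩ {ω | r (t k ω) ω = i} =
      {ω | r (t k ω) ω = i ∧ r (t (k + 1) ω) ω = j} := by
    ext ω
    simp [and_comm]
  rw [hset]
  have hmap := congrArg (fun ν => ∫⁻ p, F i j p ∂ν) (h.map_next hQ hX i j)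
  simp only [lintegral_smul_measure, smul_eq_mul] at hmap
  rw [lintegral_map (hF i j) (hX₀.prodMk (h.measurable_remaining k (d i))),
    lintegral_prod _ (hF i j).aemeasurable, lintegral_map (hmeas j) hX₀] at hmap
  rw [← hmap]
  refine setLIntegral_congr_fun ((h.measurableSet_mode k i).inter (h.measurableSet_mode (k + 1) j))
    fun ω hω => ?_
  obtain ⟨h1, h2⟩ : r (t k ω) ω = i ∧ r (t (k + 1) ω) ω = j := hω
  simp only [h1, h2]

lemma ae_strictMono (h : IsSwitchingSignal μ d Q i₀ t r) (hQ : IsRateMatrix Q)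
    (hd : ∀ i, 0 ≤ d i) : ∀ᵐ ω ∂μ, StrictMono fun k => t k ω := by
  filter_upwards [ae_all_iff.2 (h.ae_lt_next hQ)] with ω hω
  refine strictMono_nat_of_lt_succ fun k => ?_
  have := hω k
  have := hd (r (t k ω) ω)
  linarith

/-- The switching instants almost surely do not accumulate. -/
lemma ae_tendsto_atTop (h : IsSwitchingSignal μ d Q i₀ t r) (hQ : IsRateMatrix Q)
    (hd : ∀ i, 0 ≤ d i) : ∀ᵐ ω ∂μ, Tendsto (fun k => t k ω) atTop atTop := by
  -- Each stage in mode i multiplies E e^{-t k} by the factor c i < 1. With finitely many modes the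
  -- factors have a maximum ρ < 1, so E e^{-t k} ≤ ρ^k, the series ∑ e^{-t k} has finite
  -- expectation, and almost surely e^{-t k} → 0.
  set c : Fin m → ℝ≥0∞ := fun i =>
    ∫⁻ s, ENNReal.ofReal (Real.exp (-(d i + s))) ∂expMeasure (-Q i i) with hc
  have hc1 : ∀ i, c i < 1 := by
    intro i
    have hexp := hQ.isProbabilityMeasure_expMeasure i
    have hlt : ∀ᵐ s ∂expMeasure (-Q i i), ENNReal.ofReal (Real.exp (-(d i + s))) < 1 := by
      filter_upwards [ae_pos_expMeasure (hQ.rate_pos i)] with s hs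
      rw [ENNReal.ofReal_lt_one, Real.exp_lt_one_iff]
      linarith [hd i]
    have hle : c i ≤ 1 := by
      refine (lintegral_mono_ae (hlt.mono fun s hs => hs.le)).trans ?_
      simp
    have := lintegral_strict_mono (μ := expMeasure (-Q i i)) (g := fun _ => (1 : ℝ≥0∞))
      (IsProbabilityMeasure.ne_zero _) aemeasurable_const (hle.trans_lt ENNReal.one_lt_top).ne hlt
    rwa [lintegral_one, measure_univ] at this
  set ρ : ℝ≥0∞ := Finset.univ.sup c with hρ
  have hρ1 : ρ < 1 := (Finset.sup_lt_iff (by simp)).2 fun i _ => hc1 i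
  have hstep : ∀ k, ∫⁻ ω, ENNReal.ofReal (Real.exp (-t (k + 1) ω)) ∂μ ≤
      ρ * ∫⁻ ω, ENNReal.ofReal (Real.exp (-t k ω)) ∂μ := by
    intro k
    have key := h.lintegral_next hQ (k := k) (measurable_history_time t r le_rfl)
      (F := fun i _ p => ENNReal.ofReal (Real.exp (-(p.1 + d i + p.2)))) (fun i j => by fun_prop)
    have hl : ∀ ω, t k ω + d (r (t k ω) ω) + (t (k + 1) ω - (t k ω + d (r (t k ω) ω))) =
      t (k + 1) ω := fun ω => by ring
    simp only [hl] at key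
    rw [key, ← lintegral_const_mul _ (by have := h.measurable_time k; fun_prop)]
    refine lintegral_mono fun ω => ?_
    set i := r (t k ω) ω
    have hin : ∫⁻ s, ENNReal.ofReal (Real.exp (-(t k ω + d i + s))) ∂expMeasure (-Q i i) =
        ENNReal.ofReal (Real.exp (-t k ω)) * c i := by
      rw [hc, ← lintegral_const_mul _ (by fun_prop)]
      refine lintegral_congr fun s => ?_
      rw [← ENNReal.ofReal_mul (Real.exp_pos _).le, ← Real.exp_add]
      congr 2
      ring
    simp only [hin]
    rw [← Finset.sum_mul, hQ.sum_ofReal_jumpProb, one_mul, mul_comm]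
    gcongr
    exact Finset.le_sup (Finset.mem_univ i)
  have hpow : ∀ k, ∫⁻ ω, ENNReal.ofReal (Real.exp (-t k ω)) ∂μ ≤ ρ ^ k := by
    intro k
    induction k with
    | zero =>
      have : ∀ᵐ ω ∂μ, ENNReal.ofReal (Real.exp (-t 0 ω)) = 1 := by
        filter_upwards [h.time_zero] with ω hω
        simp [hω]
      rw [lintegral_congr_ae this]
      simp
    | succ k ih =>
      rw [pow_succ']
      exact (hstep k).trans (by gcongr)
  have hm : ∀ k, Measurable fun ω => ENNReal.ofReal (Real.exp (-t k ω)) := fun k => by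
    have := h.measurable_time k
    fun_prop
  have hfin : ∫⁻ ω, ∑' k, ENNReal.ofReal (Real.exp (-t k ω)) ∂μ ≠ ⊤ := by
    rw [lintegral_tsum fun k => (hm k).aemeasurable]
    refine ne_top_of_le_ne_top ?_ (ENNReal.tsum_le_tsum hpow)
    rw [ENNReal.tsum_geometric]
    exact ENNReal.inv_ne_top.2 (tsub_pos_of_lt hρ1).ne'
  filter_upwards [ae_lt_top (Measurable.tsum hm) hfin] with ω hω
  have h0 := ENNReal.tendsto_atTop_zero_of_tsum_ne_top hω.ne
  have h1 : Tendsto (fun k => Real.exp (-t k ω)) atTop (𝓝 0) := by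
    have := (ENNReal.tendsto_toReal ENNReal.zero_ne_top).comp h0
    simpa [Function.comp_def, ENNReal.toReal_ofReal (Real.exp_pos _).le] using this
  have h2 := Real.tendsto_exp_comp_nhds_zero.1 h1
  simpa [Function.comp_def] using tendsto_neg_atBot_atTop.comp h2

end IsSwitchingSignal

/-! ### Trajectories along a given sequence of switches -/

lemma not_bddAbove_range_of_tendsto {τ : ℕ → ℝ} (hτlim : Tendsto τ atTop atTop) :
    ¬BddAbove (range τ) :=
  not_bddAbove_iff.2 fun b => by
    obtain ⟨k, hk⟩ := (hτlim.eventually_gt_atTop b).exists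
    exact ⟨τ k, ⟨k, rfl⟩, hk⟩

section Paths

variable {V : Type*} [NormedAddCommGroup V] [NormedSpace ℝ V] {m : ℕ} (a : Fin m → V →L[ℝ] V)

/-- `x` is a solution on `[0, ∞)` of `ẋ(s) = a_{ρ(s)} x(s)`, `x(0) = x₀`. -/
def IsPath (ρ : ℝ → Fin m) (x₀ : V) (x : ℝ → V) : Prop :=
  x 0 = x₀ ∧ ContinuousOn x (Ici 0) ∧
    ∀ s, 0 ≤ s → HasDerivWithinAt x (a (ρ s) (x s)) (Ici s) s

/-- The state at the `k`-th switching instant, when the modes `ρ l` are entered at the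
instants `τ l`. -/
noncomputable def stateAt (τ : ℕ → ℝ) (ρ : ℕ → Fin m) (x₀ : V) : ℕ → V
  | 0 => x₀
  | k + 1 => flow (a (ρ k)) (τ (k + 1) - τ k) (stateAt τ ρ x₀ k)

variable {a} [CompleteSpace V]

lemma IsPath.eq_flow {ρ : ℝ → Fin m} {x₀ : V} {x : ℝ → V} (hx : IsPath a ρ x₀ x) {τ : ℕ → ℝ}
    (hτ0 : τ 0 = 0) (hτ : StrictMono τ)
    (hρ : ∀ k, ∀ s ∈ Ico (τ k) (τ (k + 1)), ρ s = ρ (τ k)) (k : ℕ) :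
    ∀ s ∈ Icc (τ k) (τ (k + 1)),
      x s = flow (a (ρ (τ k))) (s - τ k) (stateAt a τ (fun l => ρ (τ l)) x₀ k) := by
  have hnn : ∀ k, 0 ≤ τ k := fun k => hτ0 ▸ hτ.monotone (Nat.zero_le k)
  have hstep : ∀ k, ∀ s ∈ Icc (τ k) (τ (k + 1)), x s = flow (a (ρ (τ k))) (s - τ k) (x (τ k)) := by
    intro k
    refine eq_flow_of_hasDerivWithinAt _
      (hx.2.1.mono fun s hs => (hnn k).trans hs.1) fun s hs => ?_
    have := hx.2.2 s ((hnn k).trans hs.1)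
    rwa [hρ k s hs] at this
  have hstate : ∀ k, x (τ k) = stateAt a τ (fun l => ρ (τ l)) x₀ k := by
    intro k
    induction k with
    | zero => rw [hτ0, hx.1, stateAt]
    | succ k ih =>
      rw [hstep k _ ⟨(hτ (Nat.lt_succ_self k)).le, le_rfl⟩, ih, stateAt]
  intro s hs
  rw [hstep k s hs, hstate k]

/-- The intervals between consecutive instants cover (0, ∞) because the instants tend to infinity;
on each of them the path follows a single flow. -/
lemma IsPath.lintegral_eq {ρ : ℝ → Fin m} {x₀ : V} {x : ℝ → V} (hx : IsPath a ρ x₀ x) {τ : ℕ → ℝ}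
    (hτ0 : τ 0 = 0) (hτ : StrictMono τ) (hτlim : Tendsto τ atTop atTop)
    (hρ : ∀ k, ∀ s ∈ Ico (τ k) (τ (k + 1)), ρ s = ρ (τ k)) :
    ∫⁻ s in Ici (0 : ℝ), ‖x s‖ₑ ^ 2 =
      ∑' k, ∫⁻ u in Ioc 0 (τ (k + 1) - τ k),
        ‖flow (a (ρ (τ k))) u (stateAt a τ (fun l => ρ (τ l)) x₀ k)‖ₑ ^ 2 := by
  have hU : ⋃ k, Ioc (τ k) (τ (k + 1)) = Ioi 0 := by
    have := iUnion_Ioc_map_succ_eq_Ioi (f := τ) (fun k => hτ.monotone bot_le)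
      (not_bddAbove_range_of_tendsto hτlim)
    simpa [hτ0] using this
  have hdisj : Pairwise (Function.onFun Disjoint fun k => Ioc (τ k) (τ (k + 1))) :=
    hτ.monotone.pairwise_disjoint_on_Ioc_succ
  rw [setLIntegral_congr Ioi_ae_eq_Ici.symm, ← hU,
    lintegral_iUnion (fun k => measurableSet_Ioc) hdisj]
  refine tsum_congr fun k => ?_
  rw [setLIntegral_congr_fun measurableSet_Ioc fun s hs => by
    rw [hx.eq_flow hτ0 hτ hρ k s (Ioc_subset_Icc_self hs)]]
  rw [← lintegral_indicator measurableSet_Ioc, ← lintegral_indicator measurableSet_Ioc,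
    ← lintegral_add_right_eq_self _ (τ k)]
  refine lintegral_congr fun s => ?_
  simp only [indicator, mem_Ioc, lt_add_iff_pos_left, le_sub_iff_add_le, add_sub_cancel_right]

end Paths

/-! ### Expected cost along a trajectory -/

section Expectation

variable {V : Type*} [NormedAddCommGroup V] [NormedSpace ℝ V] [FiniteDimensional ℝ V]
  [CompleteSpace V] [MeasurableSpace V] [BorelSpace V] {m : ℕ} (a : Fin m → V →L[ℝ] V)

lemma measurable_flow :
    Measurable fun p : Fin m × ℝ × V => flow (a p.1) p.2.1 p.2.2 :=
  measurable_from_prod_countable_right fun i => (continuous_flow (a i)).measurable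

lemma measurable_stateAt {Ω : Type*} {_ : MeasurableSpace Ω} {τ : ℕ → Ω → ℝ} {ρ : ℕ → Ω → Fin m}
    (x₀ : V) {k : ℕ} (hτ : ∀ l ≤ k, Measurable (τ l)) (hρ : ∀ l ≤ k, Measurable (ρ l)) :
    Measurable fun ω => stateAt a (fun l => τ l ω) (fun l => ρ l ω) x₀ k := by
  induction k with
  | zero => exact measurable_const
  | succ k ih =>
    have ih' := ih (fun l hl => hτ l (hl.trans k.le_succ)) (fun l hl => hρ l (hl.trans k.le_succ))
    exact (measurable_flow a).comp ((hρ k k.le_succ).prodMk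
      (((hτ (k + 1) le_rfl).sub (hτ k k.le_succ)).prodMk ih'))

lemma measurable_stateAt_history {Ω : Type u} (t : ℕ → Ω → ℝ) (r : ℝ → Ω → Fin m) (x₀ : V) (k : ℕ) :
    Measurable[history t r k]
      fun ω => stateAt a (fun l => t l ω) (fun l => r (t l ω) ω) x₀ k :=
  measurable_stateAt a x₀ (fun _ hl => measurable_history_time t r hl)
    (fun _ hl => measurable_history_mode t r hl)

namespace IsSwitchingSignal

variable {Ω : Type u} [MeasurableSpace Ω] {μ : Measure Ω} {d : Fin m → ℝ}
  {Q : Matrix (Fin m) (Fin m) ℝ} {i₀ : Fin m} {t : ℕ → Ω → ℝ} {r : ℝ → Ω → Fin m}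
  [IsProbabilityMeasure μ]

/-- The Markov property: the state at instant k depends on the past only, so conditioning the
(k+1)-th stage on it replaces f by `step` f, and induction applies to the new function. -/
lemma lintegral_stateAt (h : IsSwitchingSignal μ d Q i₀ t r) (hQ : IsRateMatrix Q) (x₀ : V) (k : ℕ)
    {f : Fin m → V → ℝ≥0∞} (hf : ∀ i, Measurable (f i)) :
    ∫⁻ ω, f (r (t k ω) ω) (stateAt a (fun l => t l ω) (fun l => r (t l ω) ω) x₀ k) ∂μ =
      (step a d Q)^[k] f i₀ x₀ := by
  have := fun i => hQ.isProbabilityMeasure_expMeasure i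
  induction k generalizing f with
  | zero =>
    have h0 : ∀ᵐ ω ∂μ, f (r (t 0 ω) ω) x₀ = f i₀ x₀ := by
      filter_upwards [h.time_zero, h.mode_zero] with ω h1 h2
      rw [h1, h2]
    simp only [stateAt, Function.iterate_zero, id_eq]
    rw [lintegral_congr_ae h0]
    simp
  | succ k ih =>
    have key := h.lintegral_next hQ (measurable_stateAt_history a t r x₀ k)
      (F := fun i j p => f j (flow (a i) (d i + p.2) p.1)) fun i j =>
        (hf j).comp ((continuous_flow (a i)).measurable.comp
          ((measurable_snd.const_add (d i)).prodMk measurable_fst))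
    have hl : ∀ ω, d (r (t k ω) ω) + (t (k + 1) ω - (t k ω + d (r (t k ω) ω))) =
      t (k + 1) ω - t k ω := fun ω => by ring
    simp only [hl] at key
    rw [Function.iterate_succ_apply, ← ih (measurable_step a d Q hf)]
    exact key

lemma lintegral_stage (h : IsSwitchingSignal μ d Q i₀ t r) (hQ : IsRateMatrix Q) (x₀ : V) (k : ℕ) :
    ∫⁻ ω, (∫⁻ u in Ioc 0 (t (k + 1) ω - t k ω), ‖flow (a (r (t k ω) ω)) u
        (stateAt a (fun l => t l ω) (fun l => r (t l ω) ω) x₀ k)‖ₑ ^ 2) ∂μ =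
      (step a d Q)^[k] (stageCost a d Q) i₀ x₀ := by
  have := fun i => hQ.isProbabilityMeasure_expMeasure i
  rw [← h.lintegral_stateAt a hQ x₀ k (measurable_stageCost a d Q)]
  have key := h.lintegral_next hQ (measurable_stateAt_history a t r x₀ k)
    (F := fun i _ p => ∫⁻ u in Ioc 0 (d i + p.2), ‖flow (a i) u p.1‖ₑ ^ 2) fun i _ =>
      (measurable_dwellCost a i).comp (measurable_fst.prodMk (measurable_snd.const_add (d i)))
  have hl : ∀ ω, d (r (t k ω) ω) + (t (k + 1) ω - (t k ω + d (r (t k ω) ω))) =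
    t (k + 1) ω - t k ω := fun ω => by ring
  simp only [hl, ← Finset.sum_mul, hQ.sum_ofReal_jumpProb, one_mul] at key
  exact key

/-- The expected cost along any trajectory is the total cost. -/
lemma lintegral_eq_totalCost (h : IsSwitchingSignal μ d Q i₀ t r) (hQ : IsRateMatrix Q)
    (hd : ∀ i, 0 ≤ d i) (x₀ : V) {x : ℝ → Ω → V}
    (hx : ∀ᵐ ω ∂μ, IsPath a (fun s => r s ω) x₀ (fun s => x s ω)) :
    ∫⁻ ω, ∫⁻ s in Ici (0 : ℝ), ‖x s ω‖ₑ ^ 2 ∂volume ∂μ = totalCost a d Q i₀ x₀ := by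
  -- No measurability of x in ω is needed: the cost of almost every path equals an expression in the
  -- switching data alone, which is measurable.
  have hae : ∀ᵐ ω ∂μ, ∫⁻ s in Ici (0 : ℝ), ‖x s ω‖ₑ ^ 2 =
      ∑' k, ∫⁻ u in Ioc 0 (t (k + 1) ω - t k ω), ‖flow (a (r (t k ω) ω)) u
        (stateAt a (fun l => t l ω) (fun l => r (t l ω) ω) x₀ k)‖ₑ ^ 2 := by
    filter_upwards [hx, h.time_zero, h.ae_strictMono hQ hd, h.ae_tendsto_atTop hQ hd, h.mode_eq]
      with ω h1 h2 h3 h4 h5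
    exact h1.lintegral_eq h2 h3 h4 h5
  rw [lintegral_congr_ae hae, lintegral_tsum]
  · exact tsum_congr fun k => h.lintegral_stage a hQ x₀ k
  · intro k
    have hm : Measurable fun p : Fin m × V × ℝ => ∫⁻ u in Ioc 0 p.2.2, ‖flow (a p.1) u p.2.1‖ₑ ^ 2 :=
      measurable_from_prod_countable_right fun i => measurable_dwellCost a i
    have hs : Measurable fun ω => stateAt a (fun l => t l ω) (fun l => r (t l ω) ω) x₀ k :=
      measurable_stateAt a x₀ (fun l _ => h.measurable_time l) (fun l _ => h.measurable_mode l)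
    exact (hm.comp ((h.measurable_mode k).prodMk (hs.prodMk
      ((h.measurable_time (k + 1)).sub (h.measurable_time k))))).aemeasurable

end IsSwitchingSignal

end Expectation

/-! ### Existence of trajectories -/

/-- The number of positive switching instants up to time `s`. -/
noncomputable def switchCount (τ : ℕ → ℝ) (s : ℝ) : ℕ := sInf {k | s < τ (k + 1)}

lemma switchCount_eq {τ : ℕ → ℝ} (hτ : StrictMono τ) {k : ℕ} {s : ℝ}
    (hs : s ∈ Ico (τ k) (τ (k + 1))) : switchCount τ s = k := by
  refine le_antisymm (Nat.sInf_le hs.2) (le_csInf ⟨k, hs.2⟩ fun l (hl : s < τ (l + 1)) => ?_)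
  exact Nat.lt_succ_iff.1 (hτ.lt_iff_lt.1 (hs.1.trans_lt hl))

lemma switchCount_self {τ : ℕ → ℝ} (hτ : StrictMono τ) (k : ℕ) : switchCount τ (τ k) = k :=
  switchCount_eq hτ ⟨le_rfl, hτ k.lt_succ_self⟩

/-- The path is glued from the flows on the successive intervals. Each piece is used on the closed
interval, which gives right derivatives from the half-open intervals on the right and left
continuity from those on the left. -/
lemma exists_isPath {V : Type*} [NormedAddCommGroup V] [NormedSpace ℝ V] [CompleteSpace V] {m : ℕ}
    (a : Fin m → V →L[ℝ] V) {ρ : ℝ → Fin m} (x₀ : V) {τ : ℕ → ℝ}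
    (hτ0 : τ 0 = 0) (hτ : StrictMono τ) (hτlim : Tendsto τ atTop atTop)
    (hρ : ∀ k, ∀ s ∈ Ico (τ k) (τ (k + 1)), ρ s = ρ (τ k)) :
    ∃ x, IsPath a ρ x₀ x := by
  set y : ℕ → V := stateAt a τ (fun l => ρ (τ l)) x₀ with hy
  set f : ℕ → ℝ → V := fun k s => flow (a (ρ (τ k))) (s - τ k) (y k) with hf
  have hfd : ∀ k s, HasDerivAt (f k) (a (ρ (τ k)) (f k s)) s := by
    intro k s
    have := (hasDerivAt_flow (a (ρ (τ k))) (s - τ k) (y k)).scomp s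
      ((hasDerivAt_id s).sub_const (τ k))
    simpa [Function.comp_def] using this
  set x : ℝ → V := fun s => f (switchCount τ s) s with hx
  have hxk : ∀ k, ∀ s ∈ Icc (τ k) (τ (k + 1)), x s = f k s := by
    intro k s hs
    rcases hs.2.lt_or_eq with h | h
    · simp only [hx]
      rw [switchCount_eq hτ ⟨hs.1, h⟩]
    -- At the right end point the count is already k + 1, and piece k + 1 starts at the value where
    -- piece k ends.
    · simp only [hx, h]
      rw [switchCount_self hτ]
      simp only [hf, sub_self, flow_zero]
      rw [hy, stateAt]
  have hIco : ⋃ k, Ico (τ k) (τ (k + 1)) = Ici 0 := by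
    have := iUnion_Ico_map_succ_eq_Ici (f := τ) (fun k => hτ.monotone bot_le)
      (not_bddAbove_range_of_tendsto hτlim)
    simpa [hτ0] using this
  have hIoc : ⋃ k, Ioc (τ k) (τ (k + 1)) = Ioi 0 := by
    have := iUnion_Ioc_map_succ_eq_Ioi (f := τ) (fun k => hτ.monotone bot_le)
      (not_bddAbove_range_of_tendsto hτlim)
    simpa [hτ0] using this
  have hright : ∀ s, 0 ≤ s → HasDerivWithinAt x (a (ρ s) (x s)) (Ici s) s := by
    intro s hs
    obtain ⟨k, hk⟩ := mem_iUnion.1 (hIco.symm ▸ mem_Ici.2 hs : s ∈ ⋃ k, Ico (τ k) (τ (k + 1)))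
    rw [hρ k s hk, hxk k s (Ico_subset_Icc_self hk)]
    refine (hfd k s).hasDerivWithinAt.congr_of_eventuallyEq ?_ (hxk k s (Ico_subset_Icc_self hk))
    filter_upwards [Icc_mem_nhdsGE hk.2] with s' hs'
    exact hxk k s' ⟨hk.1.trans hs'.1, hs'.2⟩
  refine ⟨x, ?_, fun s hs => ?_, hright⟩
  · rw [hxk 0 0 ⟨hτ0.le, hτ0 ▸ (hτ Nat.zero_lt_one).le⟩]
    simp [hf, hτ0, hy, stateAt]
  · rcases (mem_Ici.1 hs).eq_or_lt with h | h
    · subst h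
      exact (hright 0 le_rfl).continuousWithinAt
    · refine (continuousAt_iff_continuous_left_right.2
        ⟨?_, (hright s hs).continuousWithinAt⟩).continuousWithinAt
      obtain ⟨k, hk⟩ := mem_iUnion.1 (hIoc.symm ▸ mem_Ioi.2 h : s ∈ ⋃ k, Ioc (τ k) (τ (k + 1)))
      refine (hfd k s).continuousAt.continuousWithinAt.congr_of_eventuallyEq ?_
        (hxk k s (Ioc_subset_Icc_self hk))
      filter_upwards [Icc_mem_nhdsLE hk.1] with s' hs'
      exact hxk k s' ⟨hs'.1, hs'.2.trans hk.2⟩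

lemma integral_eq_sum_fibers {Ω ι : Type*} [MeasurableSpace Ω] [Fintype ι] [MeasurableSpace ι]
    [MeasurableSingletonClass ι] {μ : Measure Ω} {g : Ω → ι} (hg : Measurable g) {f : Ω → ℝ}
    (hf : Integrable f μ) :
    ∫ ω, f ω ∂μ = ∑ i, ∫ ω in {ω | g ω = i}, f ω ∂μ := by
  have h := integral_iUnion_fintype (s := fun i => {ω | g ω = i})
    (fun i => hg (measurableSet_singleton i))
    (fun i j hij => Set.disjoint_left.2 fun ω hi hj => hij (hi.symm.trans hj))
    fun i => hf.integrableOn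
  rw [← h, iUnion_eq_univ_iff.2 fun ω => ⟨g ω, rfl⟩, setIntegral_univ]

/-! ### Existence of switching signals -/

section Construction

variable {m : ℕ} (d : Fin m → ℝ) (Q : Matrix (Fin m) (Fin m) ℝ) (i₀ : Fin m)

/-- The joint law of the next mode and of the random dwell time in mode `i`. -/
noncomputable def nextLaw (i : Fin m) : Measure (Fin m × ℝ) :=
  (∑ j, ENNReal.ofReal (jumpProb Q i j) • Measure.dirac j).prod (expMeasure (-Q i i))

variable {Q}

lemma IsRateMatrix.isProbabilityMeasure_nextLaw (hQ : IsRateMatrix Q) (i : Fin m) :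
    IsProbabilityMeasure (nextLaw Q i) := by
  have := hQ.isProbabilityMeasure_expMeasure i
  have : IsProbabilityMeasure (∑ j, ENNReal.ofReal (jumpProb Q i j) • Measure.dirac j) :=
    ⟨by simp [hQ.sum_ofReal_jumpProb]⟩
  unfold nextLaw
  infer_instance

/-- The positive number `s`, or `1` if `s` is not positive. -/
noncomputable def makePos (s : ℝ) : ℝ := if 0 < s then s else 1

lemma makePos_pos (s : ℝ) : 0 < makePos s := by
  unfold makePos
  split_ifs with h
  · exact h
  · exact one_pos

lemma measurable_makePos : Measurable makePos :=
  Measurable.ite measurableSet_Ioi measurable_id measurable_const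

lemma expMeasure_compl_Iic {c : ℝ} (hc : 0 < c) {s : ℝ} (hs : 0 ≤ s) :
    expMeasure c (Iic s)ᶜ = ENNReal.ofReal (Real.exp (-c * s)) := by
  have := isProbabilityMeasure_expMeasure hc
  rw [prob_compl_eq_one_sub measurableSet_Iic, expMeasure_Iic_of_nonneg hc hs,
    ENNReal.sub_sub_cancel ENNReal.one_ne_top]
  rw [← ENNReal.ofReal_one]
  refine ENNReal.ofReal_le_ofReal (Real.exp_le_one_iff.2 ?_)
  nlinarith

lemma nextLaw_apply (hQ : IsRateMatrix Q) (i j : Fin m) {s : ℝ} (hs : 0 ≤ s) :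
    nextLaw Q i {p | p.1 = j ∧ s < makePos p.2} =
      ENNReal.ofReal (jumpProb Q i j * Real.exp (Q i i * s)) := by
  have hexp := hQ.isProbabilityMeasure_expMeasure i
  have hset : {p : Fin m × ℝ | p.1 = j ∧ s < makePos p.2} = {j} ×ˢ {u | s < makePos u} := by
    ext p
    simp
  have hmeas : expMeasure (-Q i i) {u | s < makePos u} = expMeasure (-Q i i) (Iic s)ᶜ := by
    refine measure_congr ?_
    filter_upwards [ae_pos_expMeasure (hQ.rate_pos i)] with u hu
    apply propext
    change s < makePos u ↔ ¬ u ≤ s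
    rw [makePos, if_pos hu, not_le]
  rw [hset, nextLaw, Measure.prod_prod, hmeas, expMeasure_compl_Iic (hQ.rate_pos i) hs, neg_neg,
    ENNReal.ofReal_mul (hQ.jumpProb_nonneg i j)]
  congr 1
  simp [Measure.finsetSum_apply, indicator]

variable (Q)

/-- The switching instants and the modes entered at these instants, when `ξ k i` consists of the
next mode and of the random dwell time if mode `i` is entered at the `k`-th switching instant. -/
noncomputable def embeddedChain (ξ : ℕ → Fin m → Fin m × ℝ) : ℕ → ℝ × Fin m
  | 0 => (0, i₀)
  | k + 1 => ((embeddedChain ξ k).1 + d (embeddedChain ξ k).2 +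
      makePos (ξ k (embeddedChain ξ k).2).2, (ξ k (embeddedChain ξ k).2).1)

lemma strictMono_embeddedChain (hd : ∀ i, 0 ≤ d i) (ξ : ℕ → Fin m → Fin m × ℝ) :
    StrictMono fun k => (embeddedChain d i₀ ξ k).1 :=
  strictMono_nat_of_lt_succ fun k => by
    have h1 := hd (embeddedChain d i₀ ξ k).2
    have h2 := makePos_pos (ξ k (embeddedChain d i₀ ξ k).2).2
    simp only [embeddedChain]
    linarith

lemma measurable_embeddedChain {Ω : Type*} {_ : MeasurableSpace Ω} {ξ : ℕ → Ω → Fin m → Fin m × ℝ}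
    {k : ℕ} (hξ : ∀ l < k, Measurable (ξ l)) :
    Measurable fun ω => embeddedChain d i₀ (fun l => ξ l ω) k := by
  induction k with
  | zero => exact measurable_const
  | succ k ih =>
    have ih' := ih fun l hl => hξ l (hl.trans k.lt_succ_self)
    have hev : Measurable fun p : Fin m × (Fin m → Fin m × ℝ) => p.2 p.1 :=
      measurable_from_prod_countable_right fun i => measurable_pi_apply i
    have hnext : Measurable fun ω => ξ k ω (embeddedChain d i₀ (fun l => ξ l ω) k).2 :=
      hev.comp (ih'.snd.prodMk (hξ k k.lt_succ_self))
    exact ((ih'.fst.add ((measurable_of_finite d).comp ih'.snd)).add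
      (measurable_makePos.comp hnext.snd)).prodMk hnext.fst

/-- Every system of transition rates without absorbing modes has a switching signal. -/
theorem exists_isSwitchingSignal {Q : Matrix (Fin m) (Fin m) ℝ} (hQ : IsRateMatrix Q)
    (hd : ∀ i, 0 ≤ d i) :
    ∃ (Ω : Type u) (_ : MeasurableSpace Ω) (μ : Measure Ω) (t : ℕ → Ω → ℝ) (r : ℝ → Ω → Fin m),
      IsProbabilityMeasure μ ∧ IsSwitchingSignal μ d Q i₀ t r := by
  have := hQ.isProbabilityMeasure_nextLaw
  -- At each step an independent candidate pair (next mode, dwell time) is drawn for every possible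
  -- current mode; the chain uses only the coordinate of the actual mode.
  obtain ⟨Ω, mΩ, μ, X, hXm, hXlaw, hXind, hμ⟩ :=
    exists_iid (ULift.{u} ℕ) (Measure.pi (nextLaw Q))
  set ξ : ℕ → Ω → Fin m → Fin m × ℝ := fun k => X ⟨k⟩ with hξ
  have hξm : ∀ k, Measurable (ξ k) := fun k => hXm ⟨k⟩
  have hξind : iIndepFun ξ μ := hXind.precomp ULift.up_injective
  set S : ℕ → Ω → ℝ × Fin m := fun k ω => embeddedChain d i₀ (fun l => ξ l ω) k with hS
  have hSm : ∀ k, Measurable (S k) := fun k => measurable_embeddedChain d i₀ fun l _ => hξm l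
  set t : ℕ → Ω → ℝ := fun k ω => (S k ω).1 with ht
  -- Because of `makePos` this holds for every ω and not just almost surely, so the mode at each
  -- switching instant can be read off everywhere.
  have htmono : ∀ ω, StrictMono fun k => t k ω := fun ω => strictMono_embeddedChain d i₀ hd _
  set r : ℝ → Ω → Fin m := fun s ω => (S (switchCount (fun k => t k ω) s) ω).2 with hr
  have hrt : ∀ k ω, r (t k ω) ω = (S k ω).2 := by
    intro k ω
    simp only [hr]
    rw [switchCount_self (htmono ω) k]
  -- The first k draws determine the past up to t k, which is therefore independent of the draw ξ k.
  have hhist : ∀ k, history t r k ≤ ⨆ l ∈ Iio k, MeasurableSpace.comap (ξ l) inferInstance := by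
    intro k
    have hξl : ∀ l < k, Measurable[⨆ l ∈ Iio k, MeasurableSpace.comap (ξ l) inferInstance] (ξ l) :=
      fun l hl => (comap_measurable (ξ l)).mono (le_iSup₂_of_le l hl le_rfl) le_rfl
    refine Measurable.comap_le ?_
    refine @measurable_pi_lambda _ _ _ (_) _ _ fun l => ?_
    have hlk : (l : ℕ) ≤ k := Nat.lt_succ_iff.1 l.2
    simp only [hrt]
    exact measurable_embeddedChain d i₀ fun l' hl' => hξl l' (hl'.trans_le hlk)
  have hind : ∀ k, Indep (history t r k) (MeasurableSpace.comap (ξ k) inferInstance) μ := by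
    intro k
    have := indep_iSup_of_disjoint (fun l => (hξm l).comap_le) hξind.iIndep
      (S := Iio k) (T := {k}) (by simp)
    refine indep_of_indep_of_le this (hhist k) ?_
    simp
  have hmt : ∀ k, Measurable (t k) := fun k => (hSm k).fst
  have hmr : ∀ k, Measurable fun ω => r (t k ω) ω := fun k => by
    simp only [hrt]
    exact (hSm k).snd
  refine ⟨Ω, mΩ, μ, t, r, hμ, hmt, hmr, .of_forall fun ω => rfl, .of_forall fun ω => ?_,
    .of_forall fun ω k s hs => ?_, fun k j s hs => ?_⟩
  · exact hrt 0 ω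
  · rw [hrt]
    simp only [hr]
    rw [switchCount_eq (htmono ω) hs]
  · have hle : history t r k ≤ mΩ := (hhist k).trans (iSup₂_le fun l _ => (hξm l).comap_le)
    set E := {ω | r (t (k + 1) ω) ω = j ∧ s < t (k + 1) ω - (t k ω + d (r (t k ω) ω))} with hE
    have hEm : MeasurableSet E :=
      (hmr (k + 1) (measurableSet_singleton j)).inter (measurableSet_lt measurable_const
        ((hmt (k + 1)).sub ((hmt k).add ((measurable_of_finite d).comp (hmr k)))))
    have hgm : Measurable[history t r k] fun ω => jumpProb Q (r (t k ω) ω) j *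
        Real.exp (Q (r (t k ω) ω) (r (t k ω) ω) * s) :=
      (measurable_of_finite fun i => jumpProb Q i j * Real.exp (Q i i * s)).comp
        (measurable_history_mode t r le_rfl)
    have hgi : Integrable (fun ω => jumpProb Q (r (t k ω) ω) j *
        Real.exp (Q (r (t k ω) ω) (r (t k ω) ω) * s)) μ := by
      obtain ⟨C, hC⟩ := (finite_range fun i => ‖jumpProb Q i j * Real.exp (Q i i * s)‖).bddAbove
      exact Integrable.of_bound (hgm.mono hle le_rfl).aestronglyMeasurable C
        (.of_forall fun ω => hC ⟨r (t k ω) ω, rfl⟩)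
    have hfi : Integrable (E.indicator fun _ => (1 : ℝ)) μ := (integrable_const 1).indicator hEm
    refine (ae_eq_condExp_of_forall_setIntegral_eq hle hfi (fun B _ _ => hgi.integrableOn)
      (fun B hB _ => ?_) hgm.aestronglyMeasurable).symm
    rw [integral_eq_sum_fibers (hmr k) hgi.integrableOn,
      integral_eq_sum_fibers (hmr k) hfi.integrableOn]
    refine Finset.sum_congr rfl fun i _ => ?_
    have hIm : MeasurableSet[history t r k] {ω | r (t k ω) ω = i} :=
      measurable_history_mode t r le_rfl (measurableSet_singleton i)
    rw [Measure.restrict_restrict (hle _ hIm)]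
    set B' := {ω | r (t k ω) ω = i} ∩ B with hB'
    have hB'm : MeasurableSet[history t r k] B' := hIm.inter hB
    have hleft : ∫ ω in B', jumpProb Q (r (t k ω) ω) j *
        Real.exp (Q (r (t k ω) ω) (r (t k ω) ω) * s) ∂μ =
        ∫ ω in B', jumpProb Q i j * Real.exp (Q i i * s) ∂μ := by
      refine setIntegral_congr_fun (hle _ hB'm) fun ω hω => ?_
      have hi : r (t k ω) ω = i := hω.1
      simp only [hi]
    rw [hleft, setIntegral_const, setIntegral_indicator hEm, setIntegral_const, smul_eq_mul,
      smul_eq_mul, mul_one]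
    set G : Set (Fin m → Fin m × ℝ) := {v | (v i).1 = j ∧ s < makePos (v i).2} with hG
    have hG₀ : MeasurableSet {p : Fin m × ℝ | p.1 = j ∧ s < makePos p.2} :=
      (measurable_fst (measurableSet_singleton j)).inter
        (measurableSet_lt measurable_const (measurable_makePos.comp measurable_snd))
    have hGm : MeasurableSet G := (measurable_pi_apply (X := fun _ : Fin m => Fin m × ℝ) i) hG₀
    -- When the current mode is i, the event E concerns only coordinate i of ξ k, so its probability
    -- factors off.
    have hBE : B' ∩ E = B' ∩ ξ k ⁻¹' G := by
      ext ω
      refine and_congr_right fun hω => ?_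
      have hi : (S k ω).2 = i := (hrt k ω).symm.trans hω.1
      have h1 : r (t (k + 1) ω) ω = (ξ k ω i).1 := by
        rw [hrt, ← hi]
        rfl
      have h2 : t (k + 1) ω = t k ω + d i + makePos (ξ k ω i).2 := by
        rw [← hi]
        rfl
      simp only [hE, hG, mem_ofPred_eq, mem_preimage, h1]
      rw [h2, hrt k ω, hi, add_sub_cancel_left]
    have hlaw : μ (ξ k ⁻¹' G) = ENNReal.ofReal (jumpProb Q i j * Real.exp (Q i i * s)) := by
      rw [← Measure.map_apply (hξm k) hGm, (hXlaw ⟨k⟩).map_eq, ← nextLaw_apply hQ i j hs,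
        ← (measurePreserving_eval (nextLaw Q) i).map_eq, Measure.map_apply (measurable_pi_apply i) hG₀]
      rfl
    rw [hBE, measureReal_def, measureReal_def,
      (Indep_iff _ _ μ).1 (hind k) B' _ hB'm ⟨G, hGm, rfl⟩, hlaw, ENNReal.toReal_mul,
      ENNReal.toReal_ofReal (mul_nonneg (hQ.jumpProb_nonneg i j) (Real.exp_pos _).le)]

end Construction

/-! ### Exponential averages as discounted costs -/

lemma lintegral_expMeasure {c : ℝ} {f : ℝ → ℝ≥0∞} (hf : Measurable f) :
    ∫⁻ s, f s ∂expMeasure c = ∫⁻ s in Ioi 0, ENNReal.ofReal (c * Real.exp (-c * s)) * f s := by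
  have h : expMeasure c = volume.withDensity (exponentialPDF c) := rfl
  have hm : Measurable (exponentialPDF c) :=
    (measurable_exponentialPDFReal c).ennreal_ofReal
  rw [h, lintegral_withDensity_eq_lintegral_mul _ hm hf, setLIntegral_congr Ioi_ae_eq_Ici,
    ← lintegral_indicator measurableSet_Ici]
  refine lintegral_congr fun s => ?_
  by_cases hs : 0 ≤ s
  · simp [indicator, hs, exponentialPDF_of_nonneg hs]
  · simp [indicator, hs, exponentialPDF_of_neg (not_le.1 hs)]

/-- A form of integration by parts for the exponential distribution. -/
lemma lintegral_lintegral_Ioc_expMeasure {c : ℝ} (hc : 0 < c) {f : ℝ → ℝ≥0∞} (hf : Measurable f) :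
    ∫⁻ s, (∫⁻ u in Ioc 0 s, f u) ∂expMeasure c =
      ∫⁻ u in Ioi 0, ENNReal.ofReal (Real.exp (-c * u)) * f u := by
  have hexp := isProbabilityMeasure_expMeasure hc
  have hset : MeasurableSet {p : ℝ × ℝ | p.2 ∈ Ioc 0 p.1} :=
    (measurableSet_lt measurable_const measurable_snd).inter
      (measurableSet_le measurable_snd measurable_fst)
  have hind : ∀ s, ∫⁻ u in Ioc 0 s, f u =
      ∫⁻ u, {p : ℝ × ℝ | p.2 ∈ Ioc 0 p.1}.indicator (fun p => f p.2) (s, u) := fun s => by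
    rw [← lintegral_indicator measurableSet_Ioc]
    rfl
  simp only [hind]
  have hm : Measurable (Function.uncurry fun s u =>
      {p : ℝ × ℝ | p.2 ∈ Ioc 0 p.1}.indicator (fun p => f p.2) (s, u)) :=
    (hf.comp measurable_snd).indicator hset
  -- By Tonelli, the weight of f u is the probability e^{-cu} that the exponential time is at least
  -- u.
  rw [lintegral_lintegral_swap hm.aemeasurable,
    ← lintegral_indicator measurableSet_Ioi]
  refine lintegral_congr fun u => ?_
  by_cases hu : 0 < u
  · have hu' : u ∈ Ioi (0 : ℝ) := hu
    have hcongr : ∀ s, {p : ℝ × ℝ | p.2 ∈ Ioc 0 p.1}.indicator (fun p => f p.2) (s, u) =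
        (Ici u).indicator (fun _ => f u) s := fun s => by
      simp [indicator, hu]
    have hIci : expMeasure c (Ici u) = ENNReal.ofReal (Real.exp (-c * u)) := by
      have hu0 : expMeasure c {u} = 0 :=
        withDensity_absolutelyContinuous volume (exponentialPDF c) (measure_singleton u)
      rw [← (Ioi_ae_eq_Ici' hu0).measure_eq, ← compl_Iic, expMeasure_compl_Iic hc hu.le]
    simp only [hcongr]
    rw [lintegral_indicator_const measurableSet_Ici, indicator_of_mem hu', hIci, mul_comm]
  · simp [indicator, hu]

section Discounted

variable {V : Type*} [NormedAddCommGroup V] [NormedSpace ℝ V]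

/-- The cost `∫₀^∞ e^{κ s} f(z(s)) ds` along the solution of `ż = a z`, `z(0) = z`. -/
noncomputable def discounted (a : V →L[ℝ] V) (κ : ℝ) (f : V → ℝ≥0∞) (z : V) : ℝ≥0∞ :=
  ∫⁻ s in Ioi 0, ENNReal.ofReal (Real.exp (κ * s)) * f (flow a s z)

lemma discounted_mono (a : V →L[ℝ] V) (κ : ℝ) {f g : V → ℝ≥0∞} (hfg : ∀ z, f z ≤ g z) (z : V) :
    discounted a κ f z ≤ discounted a κ g z :=
  lintegral_mono fun _ => mul_le_mul_right (hfg _) _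

variable [CompleteSpace V]

/-- A lower bound for the discounted quadratic cost. -/
lemma exists_mul_le_discounted_norm (a : V →L[ℝ] V) {κ : ℝ} (hκ : κ ≤ 0) :
    ∃ c : ℝ, 0 < c ∧ ∀ z, ENNReal.ofReal c * ‖z‖ₑ ^ 2 ≤
      discounted a κ (fun z => ‖z‖ₑ ^ 2) z := by
  -- Only times in (0, 1] are kept: there e^{κs} ≥ e^κ, as κ ≤ 0, and the flow shrinks norms at most
  -- by the factor e^{-‖a‖}.
  refine ⟨Real.exp κ * (Real.exp (-‖a‖)) ^ 2, by positivity, fun z => ?_⟩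
  have hle : ∀ s ∈ Ioc (0 : ℝ) 1, ENNReal.ofReal (Real.exp κ * (Real.exp (-‖a‖)) ^ 2) * ‖z‖ₑ ^ 2 ≤
      ENNReal.ofReal (Real.exp (κ * s)) * ‖flow a s z‖ₑ ^ 2 := by
    intro s hs
    rw [ENNReal.ofReal_mul (Real.exp_pos _).le, mul_assoc, ENNReal.ofReal_pow (Real.exp_pos _).le,
      ← mul_pow]
    refine mul_le_mul' (ENNReal.ofReal_le_ofReal (Real.exp_le_exp.2 (by nlinarith [hs.2]))) ?_
    gcongr
    rw [← ofReal_norm, ← ofReal_norm, ← ENNReal.ofReal_mul (Real.exp_pos _).le]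
    refine ENNReal.ofReal_le_ofReal ?_
    have h1 := norm_le_norm_flow a s z
    rw [abs_of_pos hs.1] at h1
    have h2 : Real.exp (s * ‖a‖) ≤ Real.exp ‖a‖ :=
      Real.exp_le_exp.2 (mul_le_of_le_one_left (norm_nonneg a) hs.2)
    calc Real.exp (-‖a‖) * ‖z‖ ≤ Real.exp (-‖a‖) * (Real.exp ‖a‖ * ‖flow a s z‖) := by
          gcongr
          exact h1.trans (by gcongr)
      _ = ‖flow a s z‖ := by rw [← mul_assoc, ← Real.exp_add]; simp
  calc _ = ∫⁻ _ in Ioc (0 : ℝ) 1,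
        ENNReal.ofReal (Real.exp κ * (Real.exp (-‖a‖)) ^ 2) * ‖z‖ₑ ^ 2 := by simp
    _ ≤ ∫⁻ s in Ioc (0 : ℝ) 1, ENNReal.ofReal (Real.exp (κ * s)) * ‖flow a s z‖ₑ ^ 2 :=
        setLIntegral_mono' measurableSet_Ioc hle
    _ ≤ _ := lintegral_mono_set Ioc_subset_Ioi_self

/-- The cost during a fixed time is dominated by the discounted cost afterwards. -/
lemma exists_lintegral_Ioc_le (a : V →L[ℝ] V) {κ : ℝ} (hκ : κ ≤ 0) (d : ℝ) :
    ∃ C : ℝ≥0∞, C ≠ ⊤ ∧ ∀ y, ∫⁻ u in Ioc 0 d, ‖flow a u y‖ₑ ^ 2 ≤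
      C * discounted a κ (fun z => ‖z‖ₑ ^ 2) (flow a d y) := by
  obtain ⟨c, hc, hcle⟩ := exists_mul_le_discounted_norm a hκ
  set K := ENNReal.ofReal (Real.exp (|d| * ‖a‖)) with hK
  -- One factor K goes back from time d to time 0, the other forward to u ≤ d; the interval has
  -- length d, and 1/c passes to the discounted cost.
  refine ⟨(K * K) ^ 2 * ENNReal.ofReal d * (ENNReal.ofReal c)⁻¹, ?_, fun y => ?_⟩
  · have : (ENNReal.ofReal c)⁻¹ ≠ ⊤ := ENNReal.inv_ne_top.2 (ENNReal.ofReal_pos.2 hc).ne'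
    finiteness
  have h1 : ‖y‖ₑ ≤ K * ‖flow a d y‖ₑ := by
    rw [← ofReal_norm, ← ofReal_norm, ← ENNReal.ofReal_mul (Real.exp_pos _).le]
    exact ENNReal.ofReal_le_ofReal (norm_le_norm_flow a d y)
  have h2 : ∀ u ∈ Ioc 0 d, ‖flow a u y‖ₑ ^ 2 ≤ (K * K) ^ 2 * ‖flow a d y‖ₑ ^ 2 := by
    intro u hu
    rw [← mul_pow, mul_assoc]
    gcongr
    refine le_trans ?_ (mul_le_mul_right h1 K)
    rw [← ofReal_norm, ← ofReal_norm, ← ENNReal.ofReal_mul (Real.exp_pos _).le]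
    refine ENNReal.ofReal_le_ofReal ((norm_flow_le a u y).trans ?_)
    gcongr
    · exact hu.1.le
    · exact hu.2
  have h3 : ‖flow a d y‖ₑ ^ 2 ≤
      (ENNReal.ofReal c)⁻¹ * discounted a κ (fun z => ‖z‖ₑ ^ 2) (flow a d y) := by
    rw [mul_comm, ← div_eq_mul_inv, ENNReal.le_div_iff_mul_le
      (.inl (ENNReal.ofReal_pos.2 hc).ne') (.inl ENNReal.ofReal_ne_top), mul_comm]
    exact hcle _
  calc _ ≤ ∫⁻ _ in Ioc 0 d, (K * K) ^ 2 * ‖flow a d y‖ₑ ^ 2 :=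
        setLIntegral_mono' measurableSet_Ioc h2
    _ = (K * K) ^ 2 * ENNReal.ofReal d * ‖flow a d y‖ₑ ^ 2 := by
        rw [setLIntegral_const, Real.volume_Ioc, sub_zero]
        ring
    _ ≤ _ := by
        rw [mul_assoc _ _ (discounted _ _ _ _)]
        gcongr

variable [MeasurableSpace V] [BorelSpace V]

lemma measurable_comp_flow (a : V →L[ℝ] V) {f : V → ℝ≥0∞} (hf : Measurable f) (z : V) :
    Measurable fun s => f (flow a s z) :=
  hf.comp ((continuous_flow a).comp (continuous_id.prodMk continuous_const)).measurable

lemma discounted_add (a : V →L[ℝ] V) (κ : ℝ) {f g : V → ℝ≥0∞} (hf : Measurable f) (z : V) :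
    discounted a κ (fun z => f z + g z) z = discounted a κ f z + discounted a κ g z := by
  simp only [discounted, mul_add]
  refine lintegral_add_left (Measurable.mul (by fun_prop) (measurable_comp_flow a hf z)) _

end Discounted

/-! ### The cost equation -/

section Operators

lemma step_mono {V : Type*} [NormedAddCommGroup V] [NormedSpace ℝ V] {m : ℕ}
    (a : Fin m → V →L[ℝ] V) (d : Fin m → ℝ) {Q : Matrix (Fin m) (Fin m) ℝ}
    {f g : Fin m → V → ℝ≥0∞} (hfg : ∀ i z, f i z ≤ g i z) (i : Fin m) (y : V) :
    step a d Q f i y ≤ step a d Q g i y :=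
  Finset.sum_le_sum fun _ _ => mul_le_mul_right (lintegral_mono fun _ => hfg _ _) _

variable {V : Type*} [NormedAddCommGroup V] [NormedSpace ℝ V]
  [CompleteSpace V] [MeasurableSpace V] [BorelSpace V] {m : ℕ} (a : Fin m → V →L[ℝ] V)
  (d : Fin m → ℝ) {Q : Matrix (Fin m) (Fin m) ℝ}

/-- Jump probability times exponential density is Q i j / (-Q i i) · (-Q i i) e^{Q i i s} = Q i j
e^{Q i i s}; the flow over the fixed dwell time splits off. -/
lemma step_eq_discounted (hQ : IsRateMatrix Q) {f : Fin m → V → ℝ≥0∞} (hf : ∀ j, Measurable (f j))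
    (i : Fin m) (y : V) :
    step a d Q f i y = discounted (a i) (Q i i)
      (fun z => ∑ j ∈ Finset.univ.erase i, ENNReal.ofReal (Q i j) * f j z)
      (flow (a i) (d i) y) := by
  have hm : ∀ j, Measurable fun s => f j (flow (a i) (d i + s) y) := fun j =>
    (measurable_comp_flow (a i) (hf j) y).comp (measurable_const_add (d i))
  rw [step, ← Finset.add_sum_erase _ _ (Finset.mem_univ i)]
  have h0 : jumpProb Q i i = 0 := if_pos rfl
  rw [h0, ENNReal.ofReal_zero, zero_mul, zero_add]
  simp only [discounted, Finset.mul_sum]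
  rw [lintegral_finsetSum' _ fun j _ => ?_]
  · refine Finset.sum_congr rfl fun j hj => ?_
    have hji := Finset.ne_of_mem_erase hj
    rw [lintegral_expMeasure (hm j), ← lintegral_const_mul' _ _ ENNReal.ofReal_ne_top]
    refine lintegral_congr fun s => ?_
    rw [← mul_assoc, ← mul_assoc, ← ENNReal.ofReal_mul (hQ.jumpProb_nonneg i j),
      ← ENNReal.ofReal_mul (Real.exp_pos _).le, add_comm (d i) s, flow_add, neg_neg]
    congr 2
    rw [jumpProb, if_neg hji]
    have := hQ.ne_zero i
    field_simp
  · have := measurable_comp_flow (a i) (hf j) (flow (a i) (d i) y)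
    exact (Measurable.mul (by fun_prop) (this.const_mul _)).aemeasurable

lemma step_tsum {ι : Type*} [Countable ι] {f : ι → Fin m → V → ℝ≥0∞}
    (hf : ∀ k j, Measurable (f k j)) (i : Fin m) (y : V) :
    step a d Q (fun j z => ∑' k, f k j z) i y = ∑' k, step a d Q (f k) i y := by
  have hm : ∀ k j, Measurable fun s => f k j (flow (a i) (d i + s) y) := fun k j =>
    (measurable_comp_flow (a i) (hf k j) y).comp (measurable_const_add (d i))
  simp only [step]
  rw [Summable.tsum_finsetSum fun _ _ => ENNReal.summable]
  refine Finset.sum_congr rfl fun j _ => ?_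
  rw [lintegral_tsum fun k => (hm k j).aemeasurable, ENNReal.tsum_mul_left]

variable [FiniteDimensional ℝ V]

/-- The stage is cut at the end of the fixed dwell time; the random remainder is integrated by
`lintegral_lintegral_Ioc_expMeasure`. -/
lemma stageCost_eq (hQ : IsRateMatrix Q) (hd : ∀ i, 0 ≤ d i) (i : Fin m) (y : V) :
    stageCost a d Q i y = (∫⁻ u in Ioc 0 (d i), ‖flow (a i) u y‖ₑ ^ 2) +
      discounted (a i) (Q i i) (fun z => ‖z‖ₑ ^ 2) (flow (a i) (d i) y) := by
  have hexp := hQ.isProbabilityMeasure_expMeasure i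
  have hm : Measurable fun s => ‖flow (a i) s y‖ₑ ^ 2 :=
    measurable_comp_flow (a i) (f := fun z => ‖z‖ₑ ^ 2) (by fun_prop) y
  have hsplit : ∀ᵐ s ∂expMeasure (-Q i i), ∫⁻ u in Ioc 0 (d i + s), ‖flow (a i) u y‖ₑ ^ 2 =
      (∫⁻ u in Ioc 0 (d i), ‖flow (a i) u y‖ₑ ^ 2) +
        ∫⁻ u in Ioc 0 s, ‖flow (a i) u (flow (a i) (d i) y)‖ₑ ^ 2 := by
    filter_upwards [ae_pos_expMeasure (hQ.rate_pos i)] with s hs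
    rw [← Ioc_union_Ioc_eq_Ioc (hd i) (le_add_of_nonneg_right hs.le),
      lintegral_union measurableSet_Ioc (Ioc_disjoint_Ioc_of_le le_rfl)]
    congr 1
    rw [← lintegral_indicator measurableSet_Ioc, ← lintegral_indicator measurableSet_Ioc,
      ← lintegral_add_right_eq_self _ (d i)]
    refine lintegral_congr fun u => ?_
    simp only [indicator, mem_Ioc, lt_add_iff_pos_left, add_comm (d i) s, add_le_add_iff_right,
      flow_add]
  have hm' : Measurable fun s => ‖flow (a i) s (flow (a i) (d i) y)‖ₑ ^ 2 :=
    measurable_comp_flow (a i) (f := fun z => ‖z‖ₑ ^ 2) (by fun_prop) _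
  rw [stageCost, lintegral_congr_ae hsplit, lintegral_add_left measurable_const, lintegral_const,
    measure_univ, mul_one, lintegral_lintegral_Ioc_expMeasure (hQ.rate_pos i) hm', neg_neg]
  rfl

lemma totalCost_eq_add_step (hQ : IsRateMatrix Q) (i : Fin m) (y : V) :
    totalCost a d Q i y = stageCost a d Q i y + step a d Q (totalCost a d Q) i y := by
  have := fun i => hQ.isProbabilityMeasure_expMeasure i
  have h : totalCost a d Q = fun j z => ∑' k, (step a d Q)^[k] (stageCost a d Q) j z := rfl
  rw [h, step_tsum a d (measurable_iterate_step a d Q)]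
  simp only [← Function.iterate_succ_apply' (step a d Q)]
  exact tsum_eq_zero_add' ENNReal.summable

/-- A supersolution of the cost equation bounds the total cost. -/
lemma totalCost_le (hQ : IsRateMatrix Q) {f : Fin m → V → ℝ≥0∞}
    (hf : ∀ i y, stageCost a d Q i y + step a d Q f i y ≤ f i y) (i : Fin m) (y : V) :
    totalCost a d Q i y ≤ f i y := by
  have := fun i => hQ.isProbabilityMeasure_expMeasure i
  -- With S_N the N-th partial sum, S_{N+1} = `stageCost` + `step` S_N ≤ `stageCost` + `step` f ≤ f.
  have hpart : ∀ N i y,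
      ∑ k ∈ Finset.range N, (step a d Q)^[k] (stageCost a d Q) i y ≤ f i y := by
    intro N
    induction N with
    | zero => simp
    | succ N ih =>
      intro i y
      rw [Finset.sum_range_succ']
      have hs : ∑ k ∈ Finset.range N, (step a d Q)^[k + 1] (stageCost a d Q) i y =
          step a d Q (fun j z => ∑ k ∈ Finset.range N, (step a d Q)^[k] (stageCost a d Q) j z) i y := by
        simp only [Function.iterate_succ_apply']
        have := step_tsum a d (Q := Q) (ι := Finset.range N)
          (f := fun k => (step a d Q)^[(k : ℕ)] (stageCost a d Q))
          (fun k => measurable_iterate_step a d Q k) i y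
        simp only [tsum_fintype] at this
        simp only [← Finset.sum_coe_sort (Finset.range N)]
        exact this.symm
      rw [hs, add_comm]
      exact (add_le_add le_rfl (step_mono a d ih i y)).trans (hf i y)
  rw [totalCost, ENNReal.tsum_eq_iSup_nat]
  exact iSup_le fun N => hpart N i y

end Operators

/-! ### Quadratic functions with values in [0, ∞] -/

/-- `f` satisfies all linear relations between finitely many of its values that all quadratic
forms satisfy. -/
def IsQuadratic {V : Type*} [AddCommGroup V] [Module ℝ V] (f : V → ℝ≥0∞) : Prop :=
  ∀ (ι : Type) [Fintype ι] (c : ι → ℝ) (p : ι → V),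
    (∀ B : LinearMap.BilinForm ℝ V, ∑ k, c k * B (p k) (p k) = 0) →
      ∑ k, ENNReal.ofReal (c k) * f (p k) = ∑ k, ENNReal.ofReal (-c k) * f (p k)

namespace IsQuadratic

section Closure

variable {V : Type*} [AddCommGroup V] [Module ℝ V] {f g : V → ℝ≥0∞}

/-- In [0, ∞] there is no subtraction, so positive and negative coefficients stand on opposite
sides. In this form the property passes to series and integrals before finiteness is known. -/
lemma of_bilinForm (B : LinearMap.BilinForm ℝ V) (hB : ∀ z, 0 ≤ B z z) :
    IsQuadratic fun z => ENNReal.ofReal (B z z) := by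
  intro ι _ c p h
  have key : ∀ x : ι → ℝ, ∑ k, ENNReal.ofReal (x k) * ENNReal.ofReal (B (p k) (p k)) =
      ENNReal.ofReal (∑ k, max (x k) 0 * B (p k) (p k)) := by
    intro x
    rw [ENNReal.ofReal_sum_of_nonneg fun k _ => mul_nonneg (le_max_right _ _) (hB _)]
    refine Finset.sum_congr rfl fun k _ => ?_
    rw [ENNReal.ofReal_mul (le_max_right _ _)]
    congr 1
    rcases le_total (x k) 0 with hx | hx
    · simp [hx]
    · simp [hx]
  rw [key c, key fun k => -c k]
  congr 1
  rw [← sub_eq_zero, ← Finset.sum_sub_distrib]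
  refine Eq.trans ?_ (h B)
  refine Finset.sum_congr rfl fun k _ => ?_
  rw [← sub_mul]
  rcases le_total (c k) 0 with hx | hx
  · rw [max_eq_right hx, max_eq_left (neg_nonneg.2 hx), zero_sub, neg_neg]
  · rw [max_eq_left hx, max_eq_right (neg_nonpos.2 hx), sub_zero]

lemma add (hf : IsQuadratic f) (hg : IsQuadratic g) : IsQuadratic fun z => f z + g z := by
  intro ι _ c p h
  simp only [mul_add, Finset.sum_add_distrib]
  rw [hf ι c p h, hg ι c p h]

lemma const_mul (hf : IsQuadratic f) (x : ℝ≥0∞) : IsQuadratic fun z => x * f z := by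
  intro ι _ c p h
  simp only [mul_left_comm _ x, ← Finset.mul_sum]
  rw [hf ι c p h]

lemma tsum {κ : Type*} {f : κ → V → ℝ≥0∞} (hf : ∀ k, IsQuadratic (f k)) :
    IsQuadratic fun z => ∑' k, f k z := by
  intro ι _ c p h
  simp only [← ENNReal.tsum_mul_left]
  rw [← Summable.tsum_finsetSum fun _ _ => ENNReal.summable,
    ← Summable.tsum_finsetSum fun _ _ => ENNReal.summable]
  exact tsum_congr fun k => hf k ι c p h

lemma finset_sum {κ : Type*} (s : Finset κ) {f : κ → V → ℝ≥0∞} (hf : ∀ k, IsQuadratic (f k)) :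
    IsQuadratic fun z => ∑ k ∈ s, f k z := by
  have := IsQuadratic.tsum (κ := s) (f := fun k => f k) fun k => hf k
  convert this using 2 with z
  rw [tsum_fintype, Finset.sum_coe_sort s fun k => f k z]

lemma lintegral {Θ : Type*} [MeasurableSpace Θ] {ν : Measure Θ} {f : Θ → V → ℝ≥0∞}
    (hf : ∀ θ, IsQuadratic (f θ)) (hm : ∀ z, Measurable fun θ => f θ z) :
    IsQuadratic fun z => ∫⁻ θ, f θ z ∂ν := by
  intro ι _ c p h
  simp only [← lintegral_const_mul' _ _ ENNReal.ofReal_ne_top]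
  rw [← lintegral_finsetSum _ fun k _ => (hm (p k)).const_mul _,
    ← lintegral_finsetSum _ fun k _ => (hm (p k)).const_mul _]
  exact lintegral_congr fun θ => hf θ ι c p h

lemma comp_linearMap (hf : IsQuadratic f) (L : V →ₗ[ℝ] V) : IsQuadratic fun z => f (L z) := by
  intro ι _ c p h
  exact hf ι c (fun k => L (p k)) fun B => h (B.comp L L)

lemma neg (hf : IsQuadratic f) (z : V) : f (-z) = f z := by
  have h := hf Bool (fun b => if b then 1 else -1) (fun b => if b then -z else z) (by simp)
  have h1 : ENNReal.ofReal (-1) = 0 := ENNReal.ofReal_of_nonpos (by norm_num)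
  simpa [h1] using h

lemma sum_toReal_eq_zero (hf : IsQuadratic f) (hfin : ∀ z, f z ≠ ⊤) {ι : Type} [Fintype ι]
    (c : ι → ℝ) (p : ι → V) (h : ∀ B : LinearMap.BilinForm ℝ V, ∑ k, c k * B (p k) (p k) = 0) :
    ∑ k, c k * (f (p k)).toReal = 0 := by
  have key := congrArg ENNReal.toReal (hf ι c p h)
  rw [ENNReal.toReal_sum fun k _ => ENNReal.mul_ne_top ENNReal.ofReal_ne_top (hfin _),
    ENNReal.toReal_sum fun k _ => ENNReal.mul_ne_top ENNReal.ofReal_ne_top (hfin _), ← sub_eq_zero,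
    ← Finset.sum_sub_distrib] at key
  rw [← key]
  refine Finset.sum_congr rfl fun k _ => ?_
  rw [ENNReal.toReal_mul, ENNReal.toReal_mul, ← sub_mul]
  congr 1
  rcases le_total (c k) 0 with hx | hx
  · rw [ENNReal.ofReal_of_nonpos hx, ENNReal.toReal_ofReal (neg_nonneg.2 hx)]
    simp
  · rw [ENNReal.ofReal_of_nonpos (neg_nonpos.2 hx), ENNReal.toReal_ofReal hx]
    simp

/-- Expansion in a basis followed by polarization is a linear relation between values of a quadratic
form, so it holds for f as well. -/
lemma toReal_eq_sum (hf : IsQuadratic f) (hfin : ∀ z, f z ≠ ⊤) {n : ℕ}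
    (b : Module.Basis (Fin n) ℝ V) (z : V) :
    (f z).toReal = ∑ i, ∑ j, b.repr z i * b.repr z j *
      (((f (b i + b j)).toReal - (f (b i - b j)).toReal) / 4) := by
  -- The points are z itself (`none`), the sums b i + b j (`true`) and the differences b i - b j
  -- (`false`).
  have h := hf.sum_toReal_eq_zero hfin (ι := Option ((Fin n × Fin n) × Bool))
    (fun o => o.elim 1 fun q => (if q.2 then -1 else 1) * (b.repr z q.1.1 * b.repr z q.1.2 / 4))
    (fun o => o.elim z fun q => if q.2 then b q.1.1 + b q.1.2 else b q.1.1 - b q.1.2) (by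
      intro B
      have hz : B z z = ∑ i, ∑ j, b.repr z i * b.repr z j * B (b i) (b j) := by
        conv_lhs => rw [← b.sum_repr z]
        simp only [map_sum, map_smul, LinearMap.sum_apply, LinearMap.smul_apply, smul_eq_mul,
          Finset.mul_sum, mul_assoc]
        rw [Finset.sum_comm]
        refine Finset.sum_congr rfl fun i _ => Finset.sum_congr rfl fun j _ => ?_
        ring
      -- B need not be symmetric, and polarization sees only its symmetric part; hence the average
      -- of the two expansions.
      have hz' : B z z = ∑ i, ∑ j, b.repr z i * b.repr z j * B (b j) (b i) := by
        rw [hz, Finset.sum_comm]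
        refine Finset.sum_congr rfl fun i _ => Finset.sum_congr rfl fun j _ => ?_
        ring
      simp only [Fintype.sum_option, Fintype.sum_prod_type, Fintype.sum_bool, Option.elim, if_true,
        Bool.false_eq_true, if_false]
      have hhalf : B z z = (B z z + B z z) / 2 := by ring
      rw [one_mul, hhalf]
      nth_rewrite 1 [hz]
      rw [hz', ← Finset.sum_add_distrib, Finset.sum_div, ← Finset.sum_add_distrib]
      refine Finset.sum_eq_zero fun i _ => ?_
      rw [← Finset.sum_add_distrib, Finset.sum_div, ← Finset.sum_add_distrib]
      refine Finset.sum_eq_zero fun j _ => ?_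
      simp only [map_add, map_sub, LinearMap.add_apply, LinearMap.sub_apply]
      ring)
  simp only [Fintype.sum_option, Fintype.sum_prod_type, Fintype.sum_bool, Option.elim, if_true,
    Bool.false_eq_true, if_false, one_mul] at h
  rw [eq_neg_of_add_eq_zero_left h, ← Finset.sum_neg_distrib]
  refine Finset.sum_congr rfl fun i _ => ?_
  rw [← Finset.sum_neg_distrib]
  refine Finset.sum_congr rfl fun j _ => ?_
  ring

end Closure

/-- A finite quadratic function is given by a symmetric matrix. -/
lemma exists_matrix {n : ℕ} {f : EuclideanSpace ℝ (Fin n) → ℝ≥0∞} (hf : IsQuadratic f)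
    (hfin : ∀ z, f z ≠ ⊤) :
    ∃ M : Matrix (Fin n) (Fin n) ℝ, M.IsSymm ∧
      ∀ z, (f z).toReal = inner ℝ z (Matrix.toEuclideanCLM (n := Fin n) (𝕜 := ℝ) M z) := by
  set b := (EuclideanSpace.basisFun (Fin n) ℝ).toBasis with hb
  refine ⟨Matrix.of fun i j => ((f (b i + b j)).toReal - (f (b i - b j)).toReal) / 4, ?_,
    fun z => ?_⟩
  · ext i j
    rw [Matrix.transpose_apply, Matrix.of_apply, Matrix.of_apply, add_comm, ← neg_sub (b i) (b j),
      hf.neg]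
  · rw [hf.toReal_eq_sum hfin b z, Matrix.inner_toEuclideanCLM]
    simp only [dotProduct, Matrix.mulVec, Matrix.of_apply, Finset.mul_sum]
    refine Finset.sum_congr rfl fun i _ => Finset.sum_congr rfl fun j _ => ?_
    have hr : ∀ i, b.repr z i = z i := fun i => by
      simp [hb]
    rw [hr, hr]
    ring

end IsQuadratic

lemma isQuadratic_enorm_sq {V : Type*} [NormedAddCommGroup V] [InnerProductSpace ℝ V] :
    IsQuadratic fun z : V => ‖z‖ₑ ^ 2 := by
  have h := IsQuadratic.of_bilinForm (innerₗ V) fun z => by simp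
  convert h using 2 with z
  rw [innerₗ_apply_apply, real_inner_self_eq_norm_sq, ENNReal.ofReal_pow (norm_nonneg z),
    ofReal_norm]

section Costs

variable {V : Type*} [NormedAddCommGroup V] [InnerProductSpace ℝ V]

lemma IsQuadratic.comp_flow {f : V → ℝ≥0∞} (hf : IsQuadratic f) (a : V →L[ℝ] V) (s : ℝ) :
    IsQuadratic fun z => f (flow a s z) :=
  hf.comp_linearMap (flow a s).toLinearMap

variable [CompleteSpace V] [MeasurableSpace V] [BorelSpace V]

lemma IsQuadratic.discounted {f : V → ℝ≥0∞} (hf : IsQuadratic f) (hfm : Measurable f)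
    (a : V →L[ℝ] V) (κ : ℝ) : IsQuadratic (discounted a κ f) :=
  IsQuadratic.lintegral (fun s => (hf.comp_flow a s).const_mul _) fun z =>
    Measurable.mul (by fun_prop) (measurable_comp_flow a hfm z)

variable {m : ℕ} (a : Fin m → V →L[ℝ] V) (d : Fin m → ℝ) {Q : Matrix (Fin m) (Fin m) ℝ}

lemma IsQuadratic.step {f : Fin m → V → ℝ≥0∞} (hf : ∀ i, IsQuadratic (f i))
    (hfm : ∀ i, Measurable (f i)) (i : Fin m) : IsQuadratic (step a d Q f i) :=
  IsQuadratic.finset_sum _ fun j => (IsQuadratic.lintegral (fun _ => (hf j).comp_flow (a i) _)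
    fun z => (measurable_comp_flow (a i) (hfm j) z).comp (measurable_const_add (d i))).const_mul _

variable [FiniteDimensional ℝ V]

lemma isQuadratic_stageCost (hQ : IsRateMatrix Q) (hd : ∀ i, 0 ≤ d i) (i : Fin m) :
    IsQuadratic (stageCost a d Q i) := by
  have hm : Measurable fun z : V => ‖z‖ₑ ^ 2 := by fun_prop
  have h1 : IsQuadratic fun y => ∫⁻ u in Ioc 0 (d i), ‖flow (a i) u y‖ₑ ^ 2 :=
    IsQuadratic.lintegral (fun u => isQuadratic_enorm_sq.comp_flow (a i) u)
      fun z => measurable_comp_flow (a i) hm z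
  have h2 := h1.add ((isQuadratic_enorm_sq.discounted hm (a i) (Q i i)).comp_flow (a i) (d i))
  convert h2 using 2 with y
  exact stageCost_eq a d hQ hd i y

lemma isQuadratic_totalCost (hQ : IsRateMatrix Q) (hd : ∀ i, 0 ≤ d i) (i : Fin m) :
    IsQuadratic (totalCost a d Q i) := by
  have := fun i => hQ.isProbabilityMeasure_expMeasure i
  have h : ∀ k i, IsQuadratic ((SwitchedSystem.step a d Q)^[k] (stageCost a d Q) i) := by
    intro k
    induction k with
    | zero => exact isQuadratic_stageCost a d hQ hd
    | succ k ih =>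
      rw [Function.iterate_succ_apply']
      exact IsQuadratic.step a d ih (measurable_iterate_step a d Q k)
  exact IsQuadratic.tsum fun k => h k i

end Costs

/-! ### Discounted costs and Lyapunov functions -/

section Lyapunov

variable {V : Type*} [NormedAddCommGroup V] [NormedSpace ℝ V]

lemma discounted_ofReal (a : V →L[ℝ] V) (κ : ℝ) (f : V → ℝ) (z : V) :
    discounted a κ (fun z => ENNReal.ofReal (f z)) z =
      ∫⁻ s in Ioi 0, ENNReal.ofReal (Real.exp (κ * s) * f (flow a s z)) := by
  simp only [discounted, ENNReal.ofReal_mul (Real.exp_pos _).le]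

lemma step_const_mul {m : ℕ} (a : Fin m → V →L[ℝ] V) (d : Fin m → ℝ)
    {Q : Matrix (Fin m) (Fin m) ℝ} {K : ℝ≥0∞} (hK : K ≠ ⊤) (f : Fin m → V → ℝ≥0∞) (i : Fin m)
    (y : V) : step a d Q (fun j z => K * f j z) i y = K * step a d Q f i y := by
  simp only [step, lintegral_const_mul' _ _ hK, Finset.mul_sum]
  exact Finset.sum_congr rfl fun j _ => mul_left_comm _ _ _

variable [CompleteSpace V]

lemma continuous_exp_mul_comp_flow (a : V →L[ℝ] V) (κ : ℝ) {f : V → ℝ} (hf : Continuous f) (z : V) :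
    Continuous fun s => Real.exp (κ * s) * f (flow a s z) :=
  (by fun_prop : Continuous fun s => Real.exp (κ * s)).mul
    (hf.comp ((continuous_flow a).comp (continuous_id.prodMk continuous_const)))

/-- A Lyapunov function bounds the discounted cost. -/
lemma discounted_le_of_hasDerivAt (a : V →L[ℝ] V) {κ : ℝ} {p g : V → ℝ} (hp : ∀ z, 0 ≤ p z)
    (hg : ∀ z, 0 ≤ g z) (hgc : Continuous g)
    (hd : ∀ z s, HasDerivAt (fun s => p (flow a s z)) (-κ * p (flow a s z) - g (flow a s z)) s)
    (z : V) : discounted a κ (fun z => ENNReal.ofReal (g z)) z ≤ ENNReal.ofReal (p z) := by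
  have hφc := continuous_exp_mul_comp_flow a κ hgc z
  -- This primitive gives p z - e^{κN} p(flow a N z) ≤ p z for the integral over (0, N].
  have hF : ∀ s, HasDerivAt (fun s => -(Real.exp (κ * s) * p (flow a s z)))
      (Real.exp (κ * s) * g (flow a s z)) s := by
    intro s
    have h1 : HasDerivAt (fun s => Real.exp (κ * s)) (Real.exp (κ * s) * κ) s := by
      simpa using ((hasDerivAt_id s).const_mul κ).exp
    exact (h1.mul (hd z s)).neg.congr_deriv (by ring)
  have hU : Ioi (0 : ℝ) = ⋃ N : ℕ, Ioc 0 (N : ℝ) := by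
    ext s
    simp only [mem_Ioi, mem_iUnion, mem_Ioc, exists_and_left, iff_self_and]
    exact fun _ => exists_nat_ge s
  rw [discounted_ofReal, hU, setLIntegral_iUnion_of_directed _
    (Monotone.directed_le fun M N h => Ioc_subset_Ioc_right (Nat.cast_le.2 h))]
  refine iSup_le fun N => ?_
  rw [← ofReal_integral_eq_lintegral_ofReal (hφc.integrableOn_Ioc)
    (.of_forall fun s => mul_nonneg (Real.exp_pos _).le (hg _)),
    ← intervalIntegral.integral_of_le N.cast_nonneg,
    intervalIntegral.integral_eq_sub_of_hasDerivAt (fun s _ => hF s)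
      (hφc.intervalIntegrable _ _)]
  refine ENNReal.ofReal_le_ofReal ?_
  have := mul_nonneg (Real.exp_pos (κ * N)).le (hp (flow a N z))
  simp only [mul_zero, Real.exp_zero, flow_zero, one_mul]
  linarith

/-- A finite discounted cost satisfies the Lyapunov equation. -/
lemma lyapunov_eq_of_discounted (a : V →L[ℝ] V) {κ : ℝ} {f : V → ℝ} (hf : ∀ z, 0 ≤ f z)
    (hfc : Continuous f) (hfin : ∀ z, discounted a κ (fun z => ENNReal.ofReal (f z)) z ≠ ⊤)
    {p : V → ℝ} (hp : ∀ z, (discounted a κ (fun z => ENNReal.ofReal (f z)) z).toReal = p z)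
    {z : V} {δ : ℝ} (hd : HasDerivAt (fun s => p (flow a s z)) δ 0) :
    δ + κ * p z = -f z := by
  set φ : ℝ → ℝ := fun s => Real.exp (κ * s) * f (flow a s z) with hφ
  have hφc : Continuous φ := continuous_exp_mul_comp_flow a κ hfc z
  have hφ0 : ∀ s, 0 ≤ φ s := fun s => mul_nonneg (Real.exp_pos _).le (hf _)
  -- Shifting time turns the discounted cost along the flow into a tail integral of φ. Both sides
  -- are then differentiated at h = 0.
  have hshift : ∀ h, ENNReal.ofReal (Real.exp (κ * h)) *
      discounted a κ (fun z => ENNReal.ofReal (f z)) (flow a h z) =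
        ∫⁻ s in Ioi h, ENNReal.ofReal (φ s) := by
    intro h
    rw [discounted_ofReal, ← lintegral_const_mul' _ _ ENNReal.ofReal_ne_top,
      ← lintegral_indicator measurableSet_Ioi, ← lintegral_indicator measurableSet_Ioi,
      ← lintegral_add_right_eq_self ((Ioi h).indicator _) h]
    refine lintegral_congr fun s => ?_
    simp only [indicator, mem_Ioi, lt_add_iff_pos_left]
    congr 1
    rw [hφ, ← ENNReal.ofReal_mul (Real.exp_pos _).le, ← mul_assoc, ← Real.exp_add, ← flow_add]
    congr 3
    ring
  have hint : ∀ h, IntegrableOn φ (Ioi h) := by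
    intro h
    refine ⟨hφc.aestronglyMeasurable, ?_⟩
    rw [hasFiniteIntegral_iff_ofReal (.of_forall hφ0), ← hshift h]
    exact ENNReal.mul_lt_top ENNReal.ofReal_lt_top (hfin _).lt_top
  have hpint : ∀ h, Real.exp (κ * h) * p (flow a h z) = ∫ s in Ioi h, φ s := by
    intro h
    rw [integral_eq_lintegral_of_nonneg_ae (.of_forall hφ0) hφc.aestronglyMeasurable, ← hshift h,
      ENNReal.toReal_mul, hp, ENNReal.toReal_ofReal (Real.exp_pos _).le]
  have heq : (fun h => Real.exp (κ * h) * p (flow a h z)) =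
      fun h => (∫ s in Ioi 0, φ s) - ∫ s in (0 : ℝ)..h, φ s := by
    funext h
    rw [hpint h, ← intervalIntegral.integral_Ioi_sub_Ioi' (hint 0) (hint h), sub_sub_cancel]
  have h1 : HasDerivAt (fun s => Real.exp (κ * s)) (Real.exp (κ * 0) * κ) 0 := by
    simpa using ((hasDerivAt_id (0 : ℝ)).const_mul κ).exp
  have h2 := h1.mul hd
  have h3 : HasDerivAt (fun h => (∫ s in Ioi 0, φ s) - ∫ s in (0 : ℝ)..h, φ s) (-φ 0) 0 := by
    simpa using (intervalIntegral.integral_hasDerivAt_right (hφc.intervalIntegrable 0 0)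
      (hφc.stronglyMeasurableAtFilter _ _) hφc.continuousAt).const_sub (∫ s in Ioi 0, φ s)
  have h4 := h2.unique (heq ▸ h3)
  simp only [hφ, mul_zero, Real.exp_zero, flow_zero, one_mul] at h4
  rw [← h4]
  ring

end Lyapunov

/-! ### The coupled Lyapunov inequalities -/

section Matrices

variable {n : ℕ}

/-- The quadratic form of a matrix. -/
noncomputable def quadForm (M : Matrix (Fin n) (Fin n) ℝ) (z : EuclideanSpace ℝ (Fin n)) : ℝ :=
  inner ℝ z (Matrix.toEuclideanCLM (n := Fin n) (𝕜 := ℝ) M z)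

lemma continuous_quadForm (M : Matrix (Fin n) (Fin n) ℝ) : Continuous (quadForm M) := by
  unfold quadForm
  fun_prop

lemma quadForm_smul (M : Matrix (Fin n) (Fin n) ℝ) (c : ℝ) (z : EuclideanSpace ℝ (Fin n)) :
    quadForm M (c • z) = c ^ 2 * quadForm M z := by
  simp only [quadForm, map_smul, inner_smul_left, inner_smul_right]
  simp
  ring

lemma posDef_iff_quadForm {M : Matrix (Fin n) (Fin n) ℝ} :
    M.PosDef ↔ M.IsSymm ∧ ∀ z, z ≠ 0 → 0 < quadForm M z := by
  rw [Matrix.posDef_iff_dotProduct_mulVec]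
  refine and_congr (by rw [Matrix.IsHermitian, Matrix.conjTranspose_eq_transpose_of_trivial,
    Matrix.IsSymm]) ⟨fun h z hz => ?_, fun h x hx => ?_⟩
  · rw [quadForm, Matrix.inner_toEuclideanCLM]
    simpa using h (x := z.ofLp) (by simpa using hz)
  · have := h (WithLp.toLp 2 x) (by simpa using hx)
    rw [quadForm, Matrix.inner_toEuclideanCLM] at this
    simpa using this

lemma _root_.Matrix.PosDef.exists_mul_norm_sq_le {M : Matrix (Fin n) (Fin n) ℝ} (hM : M.PosDef) :
    ∃ c : ℝ, 0 < c ∧ ∀ z, c * ‖z‖ ^ 2 ≤ quadForm M z := by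
  have hpos := (posDef_iff_quadForm.1 hM).2
  -- The constant is the minimum of the form on the unit sphere, which is empty when n = 0.
  rcases (Metric.sphere (0 : EuclideanSpace ℝ (Fin n)) 1).eq_empty_or_nonempty with he | hne
  · refine ⟨1, one_pos, fun z => ?_⟩
    have hz : z = 0 := by
      by_contra hz
      refine eq_empty_iff_forall_notMem.1 he (‖z‖⁻¹ • z) ?_
      rw [mem_sphere_zero_iff_norm, norm_smul, norm_inv, norm_norm,
        inv_mul_cancel₀ (norm_ne_zero_iff.2 hz)]
    simp [hz, quadForm]
  · obtain ⟨x, hx, hmin⟩ := (isCompact_sphere (0 : EuclideanSpace ℝ (Fin n)) 1).exists_isMinOn hne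
      (continuous_quadForm M).continuousOn
    have hx0 : x ≠ 0 := by
      rintro rfl
      simp at hx
    refine ⟨quadForm M x, hpos x hx0, fun z => ?_⟩
    by_cases hz : z = 0
    · simp [hz, quadForm]
    · have hz' : ‖z‖ ≠ 0 := norm_ne_zero_iff.2 hz
      have h1 : quadForm M x ≤ quadForm M (‖z‖⁻¹ • z) := hmin (by
        rw [mem_sphere_zero_iff_norm, norm_smul, norm_inv, norm_norm, inv_mul_cancel₀ hz'])
      rw [quadForm_smul] at h1
      calc quadForm M x * ‖z‖ ^ 2 ≤ (‖z‖⁻¹ ^ 2 * quadForm M z) * ‖z‖ ^ 2 := by gcongr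
        _ = quadForm M z := by field_simp

lemma inner_toEuclideanCLM_transpose (M : Matrix (Fin n) (Fin n) ℝ)
    (y z : EuclideanSpace ℝ (Fin n)) :
    inner ℝ y (Matrix.toEuclideanCLM (n := Fin n) (𝕜 := ℝ) M.transpose z) =
      inner ℝ (Matrix.toEuclideanCLM (n := Fin n) (𝕜 := ℝ) M y) z := by
  rw [real_inner_comm z, Matrix.inner_toEuclideanCLM, Matrix.inner_toEuclideanCLM,
    Matrix.dotProduct_mulVec, Matrix.vecMul_transpose, dotProduct_comm]

lemma toEuclideanCLM_exp (M : Matrix (Fin n) (Fin n) ℝ) (s : ℝ) :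
    Matrix.toEuclideanCLM (n := Fin n) (𝕜 := ℝ) (NormedSpace.exp (s • M)) =
      flow (Matrix.toEuclideanCLM (n := Fin n) (𝕜 := ℝ) M) s := by
  let := Matrix.linftyOpNormedRing (n := Fin n) (α := ℝ)
  let := Matrix.linftyOpNormedAlgebra (n := Fin n) (R := ℝ) (α := ℝ)
  let := NormedAlgebra.restrictScalars ℚ ℝ (Matrix (Fin n) (Fin n) ℝ)
  let := NormedAlgebra.restrictScalars ℚ ℝ (EuclideanSpace ℝ (Fin n) →L[ℝ] EuclideanSpace ℝ (Fin n))
  have hc : Continuous (Matrix.toEuclideanCLM (n := Fin n) (𝕜 := ℝ)) :=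
    LinearMap.continuous_of_finiteDimensional
      ((Matrix.toEuclideanCLM (n := Fin n) (𝕜 := ℝ)).toAlgEquiv.toLinearMap)
  have h := NormedSpace.map_exp (Matrix.toEuclideanCLM (n := Fin n) (𝕜 := ℝ)) hc (s • M)
  rw [map_smul] at h
  exact h

lemma hasDerivAt_quadForm_flow (P : Matrix (Fin n) (Fin n) ℝ)
    (a : EuclideanSpace ℝ (Fin n) →L[ℝ] EuclideanSpace ℝ (Fin n)) (z : EuclideanSpace ℝ (Fin n))
    (s : ℝ) :
    HasDerivAt (fun s => quadForm P (flow a s z))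
      (inner ℝ (flow a s z) (Matrix.toEuclideanCLM (n := Fin n) (𝕜 := ℝ) P (a (flow a s z))) +
        inner ℝ (a (flow a s z)) (Matrix.toEuclideanCLM (n := Fin n) (𝕜 := ℝ) P (flow a s z))) s := by
  have h1 := hasDerivAt_flow a s z
  have h2 : HasDerivAt (fun s => Matrix.toEuclideanCLM (n := Fin n) (𝕜 := ℝ) P (flow a s z))
      (Matrix.toEuclideanCLM (n := Fin n) (𝕜 := ℝ) P (a (flow a s z))) s :=
    (Matrix.toEuclideanCLM (n := Fin n) (𝕜 := ℝ) P).hasFDerivAt.comp_hasDerivAt s h1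
  exact h1.inner ℝ h2

/-- The left-hand side of the coupled Lyapunov inequalities, with the opposite sign. -/
noncomputable def lyapunovMatrix {m : ℕ} (A : Fin m → Matrix (Fin n) (Fin n) ℝ) (d : Fin m → ℝ)
    (Q : Matrix (Fin m) (Fin m) ℝ) (P : Fin m → Matrix (Fin n) (Fin n) ℝ) (i : Fin m) :
    Matrix (Fin n) (Fin n) ℝ :=
  -((A i).transpose * P i + P i * A i + Q i i • P i +
    ∑ j ∈ Finset.univ.erase i, Q i j •
      (NormedSpace.exp (d j • (A j).transpose) * P j * NormedSpace.exp (d j • A j)))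

variable {m : ℕ} (A : Fin m → Matrix (Fin n) (Fin n) ℝ) (d : Fin m → ℝ)
    (Q : Matrix (Fin m) (Fin m) ℝ) (P : Fin m → Matrix (Fin n) (Fin n) ℝ)

lemma exp_smul_transpose (M : Matrix (Fin n) (Fin n) ℝ) (s : ℝ) :
    NormedSpace.exp (s • M.transpose) = (NormedSpace.exp (s • M)).transpose := by
  rw [← Matrix.exp_transpose, Matrix.transpose_smul]

lemma isSymm_lyapunovMatrix (hP : ∀ i, (P i).IsSymm) (i : Fin m) :
    (lyapunovMatrix A d Q P i).IsSymm := by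
  have hP' : ∀ i, (P i).transpose = P i := hP
  simp only [Matrix.IsSymm, lyapunovMatrix, exp_smul_transpose, Matrix.transpose_neg,
    Matrix.transpose_add, Matrix.transpose_mul, Matrix.transpose_smul, Matrix.transpose_sum,
    Matrix.transpose_transpose, hP', Matrix.mul_assoc]
  rw [add_comm (P i * A i)]

lemma quadForm_lyapunovMatrix (i : Fin m) (z : EuclideanSpace ℝ (Fin n)) :
    quadForm (lyapunovMatrix A d Q P i) z =
      -((inner ℝ z (Matrix.toEuclideanCLM (n := Fin n) (𝕜 := ℝ) (P i)
            (Matrix.toEuclideanCLM (n := Fin n) (𝕜 := ℝ) (A i) z)) +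
          inner ℝ (Matrix.toEuclideanCLM (n := Fin n) (𝕜 := ℝ) (A i) z)
            (Matrix.toEuclideanCLM (n := Fin n) (𝕜 := ℝ) (P i) z)) +
        Q i i * quadForm (P i) z +
        ∑ j ∈ Finset.univ.erase i, Q i j *
          quadForm (P j) (flow (Matrix.toEuclideanCLM (n := Fin n) (𝕜 := ℝ) (A j)) (d j) z)) := by
  simp only [quadForm, lyapunovMatrix, exp_smul_transpose, map_neg, map_add, map_sum, map_mul,
    map_smul, neg_apply, add_apply,
    sum_apply, smul_apply, mul_apply_eq_comp,
    inner_neg_right, inner_add_right, inner_sum, inner_smul_right, inner_toEuclideanCLM_transpose,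
    toEuclideanCLM_exp]
  ring

variable {A d Q P}

/-- The coupled Lyapunov inequalities imply that the total cost is finite. -/
lemma totalCost_lt_top_of_posDef (hQ : IsRateMatrix Q) (hd : ∀ i, 0 ≤ d i)
    (hP : ∀ i, (P i).PosDef) (hN : ∀ i, (lyapunovMatrix A d Q P i).PosDef) (i : Fin m)
    (y : EuclideanSpace ℝ (Fin n)) :
    totalCost (fun i => Matrix.toEuclideanCLM (n := Fin n) (𝕜 := ℝ) (A i)) d Q i y < ⊤ := by
  set a : Fin m → EuclideanSpace ℝ (Fin n) →L[ℝ] EuclideanSpace ℝ (Fin n) :=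
    fun i => Matrix.toEuclideanCLM (n := Fin n) (𝕜 := ℝ) (A i) with ha
  have hp : ∀ i z, 0 ≤ quadForm (P i) z := fun i z => by
    obtain ⟨c, hc, hle⟩ := (hP i).exists_mul_norm_sq_le
    exact (by positivity : 0 ≤ c * ‖z‖ ^ 2).trans (hle z)
  choose c hc hcle using fun i => (hN i).exists_mul_norm_sq_le
  have hq : ∀ i z, 0 ≤ quadForm (lyapunovMatrix A d Q P i) z := fun i z =>
    (mul_nonneg (hc i).le (sq_nonneg ‖z‖)).trans (hcle i z)
  choose C hC hCle using fun i => exists_lintegral_Ioc_le (a i) (neg_pos.1 (hQ.rate_pos i)).le (d i)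
  set D : Fin m → EuclideanSpace ℝ (Fin n) → ℝ≥0∞ := fun i =>
    discounted (a i) (Q i i) fun z => ENNReal.ofReal (quadForm (lyapunovMatrix A d Q P i) z) with hD
  have hnorm : ∀ i z, discounted (a i) (Q i i) (fun z => ‖z‖ₑ ^ 2) z ≤
      (ENNReal.ofReal (c i))⁻¹ * D i z := by
    intro i z
    rw [mul_comm, ← div_eq_mul_inv, ENNReal.le_div_iff_mul_le
      (.inl (ENNReal.ofReal_pos.2 (hc i)).ne') (.inl ENNReal.ofReal_ne_top), mul_comm]
    simp only [hD, discounted, ← lintegral_const_mul' _ _ ENNReal.ofReal_ne_top]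
    refine lintegral_mono fun s => ?_
    rw [mul_left_comm]
    gcongr
    rw [← ofReal_norm, ← ENNReal.ofReal_pow (norm_nonneg _), ← ENNReal.ofReal_mul (hc i).le]
    exact ENNReal.ofReal_le_ofReal (hcle i _)
  -- C i pays for the fixed dwell time, 1 for the random one, and 1 / c i compares ‖·‖² with the
  -- Lyapunov form. Summing gives one constant for all modes.
  set K : ℝ≥0∞ := ∑ i, (C i + 1) * (ENNReal.ofReal (c i))⁻¹ with hK
  have hKtop : K ≠ ⊤ := by
    refine ENNReal.sum_ne_top.2 fun i _ => ENNReal.mul_ne_top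
      (ENNReal.add_ne_top.2 ⟨hC i, ENNReal.one_ne_top⟩) ?_
    exact ENNReal.inv_ne_top.2 (ENNReal.ofReal_pos.2 (hc i)).ne'
  have hstage : ∀ i y, stageCost a d Q i y ≤ K * D i (flow (a i) (d i) y) := by
    intro i y
    rw [stageCost_eq a d hQ hd]
    calc _ ≤ C i * discounted (a i) (Q i i) (fun z => ‖z‖ₑ ^ 2) (flow (a i) (d i) y) +
          1 * discounted (a i) (Q i i) (fun z => ‖z‖ₑ ^ 2) (flow (a i) (d i) y) := by
          rw [one_mul]
          gcongr
          exact hCle i y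
      _ ≤ (C i + 1) * ((ENNReal.ofReal (c i))⁻¹ * D i (flow (a i) (d i) y)) := by
          rw [← add_mul]
          gcongr
          exact hnorm i _
      _ ≤ K * D i (flow (a i) (d i) y) := by
          rw [← mul_assoc]
          gcongr
          exact Finset.single_le_sum (f := fun i => (C i + 1) * (ENNReal.ofReal (c i))⁻¹)
            (fun _ _ => zero_le) (Finset.mem_univ i)
  set v : Fin m → EuclideanSpace ℝ (Fin n) → ℝ≥0∞ := fun i y =>
    ENNReal.ofReal (quadForm (P i) (flow (a i) (d i) y)) with hv
  have hflow : ∀ j, Continuous fun z => flow (a j) (d j) z := fun j => (flow (a j) (d j)).continuous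
  have hvm : ∀ j, Measurable (v j) := fun j =>
    (((continuous_quadForm (P j)).comp (hflow j)).measurable).ennreal_ofReal
  have hlyap : ∀ i y, D i (flow (a i) (d i) y) + step a d Q v i y ≤ v i y := by
    intro i y
    -- By definition of `lyapunovMatrix`, the form of P i has derivative -(Q i i) P i - g along the
    -- flow, so its value bounds the discounted cost of g. The two summands of g produce D i and
    -- `step` v.
    set g : EuclideanSpace ℝ (Fin n) → ℝ := fun z => quadForm (lyapunovMatrix A d Q P i) z +
      ∑ j ∈ Finset.univ.erase i, Q i j * quadForm (P j) (flow (a j) (d j) z) with hg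
    have hs0 : ∀ z, ∀ j ∈ Finset.univ.erase i,
        0 ≤ Q i j * quadForm (P j) (flow (a j) (d j) z) := fun z j hj =>
      mul_nonneg (hQ.nonneg i j (Finset.ne_of_mem_erase hj)) (hp j _)
    have hgc : Continuous g := (continuous_quadForm _).add
      (continuous_finsetSum _ fun j _ => ((continuous_quadForm (P j)).comp (hflow j)).const_mul _)
    have hle := discounted_le_of_hasDerivAt (a i) (κ := Q i i) (hp i)
      (fun z => add_nonneg (hq i z) (Finset.sum_nonneg (hs0 z))) hgc (fun z s => by
        refine (hasDerivAt_quadForm_flow (P i) (a i) z s).congr_deriv ?_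
        simp only [quadForm_lyapunovMatrix, ha]
        ring) (flow (a i) (d i) y)
    refine le_trans (le_of_eq ?_) hle
    rw [step_eq_discounted a d hQ hvm, hD,
      ← discounted_add _ _ (continuous_quadForm _).measurable.ennreal_ofReal]
    congr 1
    funext z
    rw [ENNReal.ofReal_add (hq i z) (Finset.sum_nonneg (hs0 z)),
      ENNReal.ofReal_sum_of_nonneg (hs0 z)]
    congr 1
    refine Finset.sum_congr rfl fun j hj => ?_
    rw [ENNReal.ofReal_mul (hQ.nonneg i j (Finset.ne_of_mem_erase hj))]
  refine (totalCost_le a d hQ (f := fun i y => K * v i y) (fun i y => ?_) i y).trans_lt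
    (ENNReal.mul_lt_top hKtop.lt_top ENNReal.ofReal_lt_top)
  rw [step_const_mul a d hKtop]
  refine (add_le_add (hstage i y) le_rfl).trans ?_
  rw [← mul_add]
  exact mul_le_mul_right (hlyap i y) K

/-- If the total cost is finite, then the coupled Lyapunov inequalities have a solution. -/
lemma exists_posDef_of_totalCost_lt_top (hQ : IsRateMatrix Q) (hd : ∀ i, 0 ≤ d i)
    (hW : ∀ i y, totalCost (fun i => Matrix.toEuclideanCLM (n := Fin n) (𝕜 := ℝ) (A i)) d Q i y < ⊤) :
    ∃ P : Fin m → Matrix (Fin n) (Fin n) ℝ, (∀ i, (P i).PosDef) ∧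
      ∀ i, (lyapunovMatrix A d Q P i).PosDef := by
  have hexp := fun i => hQ.isProbabilityMeasure_expMeasure i
  set a : Fin m → EuclideanSpace ℝ (Fin n) →L[ℝ] EuclideanSpace ℝ (Fin n) :=
    fun i => Matrix.toEuclideanCLM (n := Fin n) (𝕜 := ℝ) (A i) with ha
  have hWm : ∀ i, Measurable (totalCost a d Q i) := measurable_totalCost a d Q
  have hWq : ∀ i, IsQuadratic (totalCost a d Q i) := isQuadratic_totalCost a d hQ hd
  choose M hMsymm hM using fun i => (hWq i).exists_matrix fun z => (hW i z).ne
  have hMnn : ∀ i z, 0 ≤ quadForm (M i) z := fun i z =>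
    ENNReal.toReal_nonneg.trans_eq (hM i z)
  have hWM : ∀ i z, totalCost a d Q i z = ENNReal.ofReal (quadForm (M i) z) := fun i z => by
    rw [quadForm, ← hM, ENNReal.ofReal_toReal (hW i z).ne]
  have hnm : Measurable fun z : EuclideanSpace ℝ (Fin n) => ‖z‖ₑ ^ 2 := by fun_prop
  set f : Fin m → EuclideanSpace ℝ (Fin n) → ℝ := fun i z =>
    ‖z‖ ^ 2 + ∑ j ∈ Finset.univ.erase i, Q i j * quadForm (M j) z with hf
  have hs0 : ∀ i z, ∀ j ∈ Finset.univ.erase i, 0 ≤ Q i j * quadForm (M j) z := fun i z j hj =>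
    mul_nonneg (hQ.nonneg i j (Finset.ne_of_mem_erase hj)) (hMnn j _)
  have hf0 : ∀ i z, 0 ≤ f i z := fun i z => add_nonneg (sq_nonneg _) (Finset.sum_nonneg (hs0 i z))
  have hfc : ∀ i, Continuous (f i) := fun i => (continuous_norm.pow 2).add
    (continuous_finsetSum _ fun j _ => (continuous_quadForm (M j)).const_mul _)
  have hfe : ∀ i, (fun z => ENNReal.ofReal (f i z)) = fun z => ‖z‖ₑ ^ 2 +
      ∑ j ∈ Finset.univ.erase i, ENNReal.ofReal (Q i j) * totalCost a d Q j z := by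
    intro i
    funext z
    rw [ENNReal.ofReal_add (sq_nonneg _) (Finset.sum_nonneg (hs0 i z)),
      ENNReal.ofReal_sum_of_nonneg (hs0 i z), ENNReal.ofReal_pow (norm_nonneg z), ofReal_norm]
    congr 1
    refine Finset.sum_congr rfl fun j hj => ?_
    rw [ENNReal.ofReal_mul (hQ.nonneg i j (Finset.ne_of_mem_erase hj)), hWM]
  -- P comes from this cost after the fixed dwell time, not from the total cost, whose matrix M
  -- enters only through f.
  set U : Fin m → EuclideanSpace ℝ (Fin n) → ℝ≥0∞ := fun i =>
    discounted (a i) (Q i i) fun z => ENNReal.ofReal (f i z) with hU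
  have hUW : ∀ i y, U i (flow (a i) (d i) y) ≤ totalCost a d Q i y := by
    intro i y
    rw [totalCost_eq_add_step a d hQ, stageCost_eq a d hQ hd, step_eq_discounted a d hQ hWm,
      add_assoc, ← discounted_add _ _ hnm, hU]
    simp only [hfe]
    exact le_add_self
  have hUfin : ∀ i z, U i z ≠ ⊤ := by
    intro i z
    -- Every z is reached at the end of a fixed dwell time, since the flow is invertible.
    have h := hUW i (flow (a i) (-d i) z)
    rw [← flow_add, add_neg_cancel, flow_zero] at h
    exact (h.trans_lt (hW i _)).ne
  have hUq : ∀ i, IsQuadratic (U i) := by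
    intro i
    have h1 : IsQuadratic fun z => ENNReal.ofReal (f i z) := by
      rw [hfe i]
      exact isQuadratic_enorm_sq.add
        (IsQuadratic.finset_sum _ fun j => (hWq j).const_mul _)
    exact h1.discounted (hfc i).measurable.ennreal_ofReal (a i) (Q i i)
  choose P hPsymm hP using fun i => (hUq i).exists_matrix (hUfin i)
  have hPU : ∀ i z, U i z = ENNReal.ofReal (quadForm (P i) z) := fun i z => by
    rw [quadForm, ← hP, ENNReal.ofReal_toReal (hUfin i z)]
  have hle : ∀ j z, quadForm (P j) (flow (a j) (d j) z) ≤ quadForm (M j) z := by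
    intro j z
    have h := hUW j z
    rw [hPU, hWM] at h
    exact (ENNReal.ofReal_le_ofReal_iff (hMnn j z)).1 h
  refine ⟨P, fun i => posDef_iff_quadForm.2 ⟨hPsymm i, fun z hz => ?_⟩,
    fun i => posDef_iff_quadForm.2 ⟨isSymm_lyapunovMatrix A d Q P hPsymm i, fun z hz => ?_⟩⟩
  · obtain ⟨c, hc, hcle⟩ := exists_mul_le_discounted_norm (a i) (neg_pos.1 (hQ.rate_pos i)).le
    have h1 : ENNReal.ofReal c * ‖z‖ₑ ^ 2 ≤ U i z := by
      refine (hcle z).trans (discounted_mono _ _ (fun z => ?_) z)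
      rw [congrFun (hfe i) z]
      exact le_self_add
    rw [hPU] at h1
    refine ENNReal.ofReal_pos.1 (lt_of_lt_of_le ?_ h1)
    have : ‖z‖ₑ ≠ 0 := enorm_ne_zero.2 hz
    exact ENNReal.mul_pos (ENNReal.ofReal_pos.2 hc).ne' (pow_ne_zero 2 this)
  -- The Lyapunov equation leaves ‖z‖² + ∑ Q i j (M j(z) - P j(flow (a j) (d j) z)), and each
  -- bracket is nonnegative by `hle`.
  · have hder := hasDerivAt_quadForm_flow (P i) (a i) z 0
    have h1 := lyapunov_eq_of_discounted (a i) (hf0 i) (hfc i) (hUfin i) (hP i) hder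
    rw [quadForm_lyapunovMatrix]
    simp only [flow_zero] at h1
    have h2 : ∑ j ∈ Finset.univ.erase i, Q i j * quadForm (P j) (flow (a j) (d j) z) ≤
        ∑ j ∈ Finset.univ.erase i, Q i j * quadForm (M j) z :=
      Finset.sum_le_sum fun j hj =>
        mul_le_mul_of_nonneg_left (hle j z) (hQ.nonneg i j (Finset.ne_of_mem_erase hj))
    have h3 : 0 < ‖z‖ ^ 2 := by
      have := norm_pos_iff.2 hz
      positivity
    simp only [hf, ha] at h1 h2 ⊢
    simp only [quadForm] at h1 h2 ⊢
    linarith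

end Matrices

/-! ### Stability as finiteness of the total cost -/

/-- Stochastic stability means that the total cost is finite. -/
lemma stochasticallyStable_iff {m n : ℕ} (A : Fin m → Matrix (Fin n) (Fin n) ℝ) {d : Fin m → ℝ}
    (hd : ∀ i, 0 ≤ d i) {Q : Matrix (Fin m) (Fin m) ℝ} (hQ : IsRateMatrix Q) :
    StochasticallyStable.{u} A d Q ↔ ∀ i y,
      totalCost (fun i => Matrix.toEuclideanCLM (n := Fin n) (𝕜 := ℝ) (A i)) d Q i y < ⊤ := by
  constructor
  · intro h i y
    obtain ⟨Ω, mΩ, μ, t, r, hμ, hr⟩ := exists_isSwitchingSignal.{u} d i hQ hd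
    have hpath : ∀ᵐ ω ∂μ, ∃ x, IsPath
        (fun i => Matrix.toEuclideanCLM (n := Fin n) (𝕜 := ℝ) (A i)) (fun s => r s ω) y x := by
      filter_upwards [hr.time_zero, hr.ae_strictMono hQ hd, hr.ae_tendsto_atTop hQ hd, hr.mode_eq]
        with ω h2 h3 h4 h5
      exact exists_isPath _ y h2 h3 h4 h5
    classical
    -- A path is chosen separately for each ω, with an arbitrary function on the null set where none
    -- is provided; `IsTrajectory` asks for no measurability in ω.
    have hx : ∀ᵐ ω ∂μ, IsPath (fun i => Matrix.toEuclideanCLM (n := Fin n) (𝕜 := ℝ) (A i))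
        (fun s => r s ω) y (Classical.epsilon (IsPath
          (fun i => Matrix.toEuclideanCLM (n := Fin n) (𝕜 := ℝ) (A i)) (fun s => r s ω) y)) :=
      hpath.mono fun ω hω => Classical.epsilon_spec hω
    have hfin := h y i Ω μ t r (fun s ω => Classical.epsilon (IsPath
      (fun i => Matrix.toEuclideanCLM (n := Fin n) (𝕜 := ℝ) (A i)) (fun s => r s ω) y) s) hr hx
    rwa [hr.lintegral_eq_totalCost _ hQ hd y hx] at hfin
  · intro h x₀ i₀ Ω _ μ _ t r x hr hx
    rw [hr.lintegral_eq_totalCost (fun i => Matrix.toEuclideanCLM (n := Fin n) (𝕜 := ℝ) (A i))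
      hQ hd x₀ hx]
    exact h i₀ x₀

end SwitchedSystem

theorem theorem1 {m n : ℕ} (A : Fin m → Matrix (Fin n) (Fin n) ℝ)
    (d : Fin m → ℝ) (hd : ∀ i, 0 ≤ d i)
    (Q : Matrix (Fin m) (Fin m) ℝ)
    (hQ_nonneg : ∀ i j, j ≠ i → 0 ≤ Q i j)
    (hQ_diag : ∀ i, Q i i = -∑ j ∈ Finset.univ.erase i, Q i j)
    (hQ_no_absorbing : ∀ i, Q i i ≠ 0) :
    SwitchedSystem.StochasticallyStable.{u} A d Q ↔
      ∃ P : Fin m → Matrix (Fin n) (Fin n) ℝ, (∀ i, (P i).PosDef) ∧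
        ∀ i, (-((A i).transpose * P i + P i * A i + Q i i • P i +
          ∑ j ∈ Finset.univ.erase i, Q i j •
            (NormedSpace.exp (d j • (A j).transpose) * P j *
              NormedSpace.exp (d j • A j)))).PosDef := by
  have hQ : SwitchedSystem.IsRateMatrix Q := ⟨hQ_nonneg, hQ_diag, hQ_no_absorbing⟩
  rw [SwitchedSystem.stochasticallyStable_iff A hd hQ]
  exact ⟨SwitchedSystem.exists_posDef_of_totalCost_lt_top hQ hd, fun ⟨_, hP, hN⟩ i y =>
    SwitchedSystem.totalCost_lt_top_of_posDef hQ hd hP hN i y⟩
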